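/- Let $\Sigma \subset \mathbb{R}^{n+1}$ be a non-empty smooth embedded hypersurface without boundary that is complete (for its intrinsic distance), has polynomial volume growth, i.e. there are constants $C$ and $d$ with $\mathrm{Vol}(B_r(0)\cap\Sigma)\le C\,r^d$ for all $r\ge 1$, and is a self-shrinker, i.e. $H=\frac{\langle x,\mathbf{n}\rangle}{2}$ on $\Sigma$, where $\mathbf{n}$ is the unit normal and $H=\operatorname{div}_\Sigma\mathbf{n}$. Let $A$ be the second fundamental form of $\Sigma$, let $L=\Delta+|A|^2+\frac12-\frac12\langle x,\nabla(\cdot)\rangle$ be the second variation operator, and let $$\mu_1=\inf_f\ \frac{\int_\Sigma\left(|\nabla f|^2-|A|^2f^2-\frac12 f^2\right)e^{-|x|^2/4}}{\int_\Sigma f^2\,e^{-|x|^2/4}}\in[-\infty,\infty)$$ be the bottom of the spectrum of $L$, where the infimum is taken over all smooth functions $f$ on $\Sigma$ with compact support that are not identically zero, $\nabla$ is the gradient on $\Sigma$, and the integrals are with respect to the $n$-dimensional volume of $\Sigma$. Then $\mu_1\le-\frac12$. -/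

import Mathlib

open scoped ContDiff Topology MeasureTheory ENNReal

namespace SelfShrinker

noncomputable section

/-- The ambient Euclidean space `ℝ^{n+1}`. -/
abbrev Ambient (n : ℕ) : Type := EuclideanSpace ℝ (Fin (n + 1))

/-- `S` is a smooth embedded hypersurface without boundary in `ℝ^{n+1}`: near each of its points it
is the zero set of a smooth function whose differential does not vanish. -/
def IsSmoothHypersurface {n : ℕ} (S : Set (Ambient n)) : Prop :=
  ∀ p ∈ S, ∃ U : Set (Ambient n), IsOpen U ∧ p ∈ U ∧ ∃ u : Ambient n → ℝ,
    ContDiffOn ℝ ∞ u U ∧ (∀ x ∈ U, fderiv ℝ u x ≠ 0) ∧ S ∩ U = {x ∈ U | u x = 0}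

/-- The intrinsic distance of `S`: the infimum of the lengths of the curves in `S` joining `x` to
`y` (it is `∞` if there is no such curve of finite length). -/
def intrinsicEDist {n : ℕ} (S : Set (Ambient n)) (x y : Ambient n) : ℝ≥0∞ :=
  ⨅ γ : {γ : ℝ → Ambient n // ContinuousOn γ (Set.Icc 0 1) ∧ Set.MapsTo γ (Set.Icc 0 1) S ∧
    γ 0 = x ∧ γ 1 = y}, eVariationOn γ.1 (Set.Icc 0 1)

/-- `S` is complete for its intrinsic distance. -/
def IsIntrinsicallyComplete {n : ℕ} (S : Set (Ambient n)) : Prop :=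
  ∀ x : ℕ → Ambient n, (∀ k, x k ∈ S) →
    (∀ ε : ℝ≥0∞, 0 < ε → ∃ N, ∀ k ≥ N, ∀ l ≥ N, intrinsicEDist S (x k) (x l) < ε) →
    ∃ y ∈ S, Filter.Tendsto (fun k => intrinsicEDist S (x k) y) Filter.atTop (𝓝 0)

/-- Polynomial volume growth: `Vol (B_r(0) ∩ S) ≤ C r^d` for all `r ≥ 1`.  The `n`-dimensional
volume is the Hausdorff measure `μHE[n]`, normalized to be Lebesgue measure on `n`-planes. -/
def HasPolynomialVolumeGrowth {n : ℕ} (S : Set (Ambient n)) : Prop :=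
  ∃ C d : ℝ, ∀ r : ℝ, 1 ≤ r → μHE[n] (Metric.ball 0 r ∩ S) ≤ ENNReal.ofReal (C * r ^ d)

/-- The tangent space of `S` at `x`.  For a smooth hypersurface the tangent cone already is a linear
subspace. -/
def tangentSpace {n : ℕ} (S : Set (Ambient n)) (x : Ambient n) : Submodule ℝ (Ambient n) :=
  Submodule.span ℝ (tangentConeAt ℝ S x)

/-- An orthonormal basis of the tangent space. -/
def tangentFrame {n : ℕ} (S : Set (Ambient n)) (x : Ambient n) :
    OrthonormalBasis (Fin (Module.finrank ℝ (tangentSpace S x))) ℝ (tangentSpace S x) :=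
  stdOrthonormalBasis ℝ (tangentSpace S x)

/-- `ν` restricts to a smooth unit normal field of `S` in a neighbourhood of `p`. -/
def IsUnitNormalNear {n : ℕ} (S : Set (Ambient n)) (p : Ambient n) (ν : Ambient n → Ambient n) :
    Prop :=
  ∃ U : Set (Ambient n), IsOpen U ∧ p ∈ U ∧ ContDiffOn ℝ ∞ ν U ∧
    ∀ x ∈ S ∩ U, ‖ν x‖ = 1 ∧ ν x ∈ (tangentSpace S x)ᗮ

/-- A smooth hypersurface has a smooth unit normal field near each of its points. -/
theorem exists_isUnitNormalNear {n : ℕ} {S : Set (Ambient n)} (hS : IsSmoothHypersurface S)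
    {p : Ambient n} (hp : p ∈ S) : ∃ ν, IsUnitNormalNear S p ν := by
  obtain ⟨U, hU, hpU, u, hu, hdu, hSU⟩ := hS p hp
  let g : Ambient n → Ambient n := fun x => (InnerProductSpace.toDual ℝ (Ambient n)).symm
    (fderiv ℝ u x)
  have hg : ContDiffOn ℝ ∞ g U :=
    (InnerProductSpace.toDual ℝ (Ambient n)).symm.contDiff.comp_contDiffOn
      (hu.fderiv_of_isOpen hU (by simp))
  have hg0 : ∀ x ∈ U, g x ≠ 0 := fun x hx h => hdu x hx (by simpa [g] using h)
  refine ⟨fun x => ‖g x‖⁻¹ • g x, U, hU, hpU, ?_, ?_⟩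
  · exact ((hg.norm ℝ hg0).inv fun x hx => norm_ne_zero_iff.2 (hg0 x hx)).smul hg
  · rintro x ⟨hxS, hxU⟩
    refine ⟨by simp [norm_smul, norm_ne_zero_iff.2 (hg0 x hxU)], ?_⟩
    refine Submodule.smul_mem _ _ ?_
    rw [Submodule.mem_orthogonal']
    intro v hv
    have h0 : fderiv ℝ u x v = 0 := by
      have hux : HasFDerivWithinAt u (fderiv ℝ u x) S x :=
        (((hu.contDiffAt (hU.mem_nhds hxU)).differentiableAt
          (by simp)).hasFDerivAt).hasFDerivWithinAt
      have hu0 : ∀ y ∈ S ∩ U, u y = 0 := fun y hy => by rw [hSU] at hy; exact hy.2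
      have hz : HasFDerivWithinAt u (0 : Ambient n →L[ℝ] ℝ) S x := by
        refine (hasFDerivWithinAt_const (0 : ℝ) x S).congr_of_eventuallyEq ?_
          (hu0 x ⟨hxS, hxU⟩)
        filter_upwards [self_mem_nhdsWithin, mem_nhdsWithin_of_mem_nhds (hU.mem_nhds hxU)]
          with y h1 h2 using hu0 y ⟨h1, h2⟩
      have hle : tangentSpace S x ≤ LinearMap.ker (fderiv ℝ u x : Ambient n →ₗ[ℝ] ℝ) :=
        Submodule.span_le.2 fun w hw => by simpa using hux.unique_on hz hw
      simpa using hle hv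
    simpa [g] using h0

/-- A smooth unit normal field `𝐧` near `p`.  It is unique up to sign along `S` near `p`; the
self-shrinker equation and `|A|²` do not depend on the sign. -/
def localNormal {n : ℕ} (S : Set (Ambient n)) (p : Ambient n) : Ambient n → Ambient n :=
  Classical.epsilon (IsUnitNormalNear S p)

/-- The mean curvature `H = div_S 𝐧` at `p`. -/
def meanCurvature {n : ℕ} (S : Set (Ambient n)) (p : Ambient n) : ℝ :=
  ∑ i, inner ℝ (fderiv ℝ (localNormal S p) p (tangentFrame S p i : Ambient n))
    (tangentFrame S p i : Ambient n)

/-- The second fundamental form `A(v, w) = -⟨D_v 𝐧, w⟩` at `p`. -/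
def secondFundamentalForm {n : ℕ} (S : Set (Ambient n)) (p : Ambient n)
    (v w : tangentSpace S p) : ℝ :=
  -inner ℝ (fderiv ℝ (localNormal S p) p (v : Ambient n)) (w : Ambient n)

/-- `|A|²` at `p`. -/
def secondFundamentalFormNormSq {n : ℕ} (S : Set (Ambient n)) (p : Ambient n) : ℝ :=
  ∑ i, ∑ j, secondFundamentalForm S p (tangentFrame S p i) (tangentFrame S p j) ^ 2

/-- The self-shrinker equation `H = ⟨x, 𝐧⟩ / 2`. -/
def SatisfiesShrinkerEquation {n : ℕ} (S : Set (Ambient n)) : Prop :=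
  ∀ p ∈ S, meanCurvature S p = inner ℝ p (localNormal S p p) / 2

/-- The gradient on `S` of a function: the vector of the tangent space that represents the
differential along `S`.  (Only the values of `f` on `S` matter.) -/
def tangentialGradient {n : ℕ} (S : Set (Ambient n)) (f : Ambient n → ℝ) (x : Ambient n) :
    tangentSpace S x :=
  (InnerProductSpace.toDual ℝ (tangentSpace S x)).symm
    ((fderivWithin ℝ f S x).comp (tangentSpace S x).subtypeL)

/-- `f` restricts to a smooth function on `S` with compact support in `S` that does not vanish
identically on `S`. -/
structure IsTestFunction {n : ℕ} (S : Set (Ambient n)) (f : Ambient n → ℝ) : Prop where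
  smooth : ∀ p ∈ S, ∃ U : Set (Ambient n), IsOpen U ∧ p ∈ U ∧ ∃ g : Ambient n → ℝ,
    ContDiffOn ℝ ∞ g U ∧ ∀ x ∈ S ∩ U, f x = g x
  compact_support : ∃ K ⊆ S, IsCompact K ∧ ∀ x ∈ S \ K, f x = 0
  ne_zero : ∃ x ∈ S, f x ≠ 0

/-- The Gaussian weighted integral `∫_S F e^{-|x|²/4}`. -/
def gaussianIntegral {n : ℕ} (S : Set (Ambient n)) (F : Ambient n → ℝ) : ℝ :=
  ∫ x in S, F x * Real.exp (-‖x‖ ^ 2 / 4) ∂μHE[n]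

/-- The Rayleigh quotient of `L = Δ + |A|² + 1/2 - ⟨x, ∇ ·⟩ / 2` in the Gaussian weighted space. -/
def rayleighQuotient {n : ℕ} (S : Set (Ambient n)) (f : Ambient n → ℝ) : ℝ :=
  gaussianIntegral S (fun x => ‖tangentialGradient S f x‖ ^ 2
      - secondFundamentalFormNormSq S x * f x ^ 2 - 1 / 2 * f x ^ 2) /
    gaussianIntegral S (fun x => f x ^ 2)

/-- The bottom `μ₁` of the spectrum of `L`, which may be `-∞`. -/
def bottomOfSpectrum {n : ℕ} (S : Set (Ambient n)) : EReal :=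
  ⨅ f : {f : Ambient n → ℝ // IsTestFunction S f}, ((rayleighQuotient S f.1 : ℝ) : EReal)

end

end SelfShrinker

namespace SelfShrinker

open Set Filter MeasureTheory Metric

/-! ### Local charts -/

section Chart

variable {n : ℕ} {S : Set (Ambient n)} {p : Ambient n}

/-! The constant function `1` would have Rayleigh quotient at most `-1/2`: its gradient vanishes and
`-|A|² ≤ 0`. It need not have compact support, so it is replaced by cut-offs `g` with `|∇g| ≤ ε` on
`S` and `g ≥ 1/4` on a fixed ball about a point of `S`. If `V` is the Gaussian volume and `D` the
denominator of the quotient, the numerator is at most `ε² V - D/2` (`gaussianIntegral_rayleigh_le`).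
Polynomial growth makes `V` finite (`integrableOn_gaussian`), and `D` is bounded below independently
of `ε` (`gaussianIntegral_sq_ge`), so `ε → 0` gives the bound.

The work lies in the cut-offs (`exists_cutoff`). Since `S` is complete only intrinsically and need
not be closed, they must be functions of the intrinsic distance. Intrinsic balls are compact by a
Hopf-Rinow argument (`isCompact_closedEBall_of_length`). The distance is merely locally Lipschitz
for the ambient metric, so it is smoothed with control of the gradient
(`exists_contDiff_approx_of_locally_lipschitz`).

Separately, `|A|²` and the gradient are defined through pointwise choices of frames and normals;
their continuity, needed for integrability, comes from frame-free formulas in terms of one local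
smooth normal. -/

theorem eq_zero_of_mem_tangentSpace_of_eqOn {F : Type*} [NormedAddCommGroup F] [NormedSpace ℝ F]
    {w : Ambient n → F} {w' : Ambient n →L[ℝ] F} (hw : HasFDerivAt w w' p) (hp : p ∈ S)
    (h0 : ∀ᶠ x in 𝓝[S] p, w x = 0) {v : Ambient n} (hv : v ∈ tangentSpace S p) : w' v = 0 := by
  have hz : HasFDerivWithinAt w (0 : Ambient n →L[ℝ] F) S p :=
    (hasFDerivWithinAt_const (0 : F) p S).congr_of_eventuallyEq h0 (h0.self_of_nhdsWithin hp)
  have hle : tangentSpace S p ≤ LinearMap.ker (w' : Ambient n →ₗ[ℝ] F) :=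
    Submodule.span_le.2 fun w hw' => by simpa using hw.hasFDerivWithinAt.unique_on hz hw'
  simpa using hle hv

theorem range_eq_top_of_ne_zero {f : Ambient n →L[ℝ] ℝ} (hf : f ≠ 0) : f.range = ⊤ :=
  LinearMap.range_eq_top.2 (LinearMap.surjective (f := (f : Ambient n →ₗ[ℝ] ℝ))
    fun h => hf (ContinuousLinearMap.coe_injective h))

theorem finrank_ker_of_ne_zero {f : Ambient n →L[ℝ] ℝ} (hf : f ≠ 0) :
    Module.finrank ℝ f.ker = n := by
  have h := LinearMap.finrank_range_add_finrank_ker (f : Ambient n →ₗ[ℝ] ℝ)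
  have h2 : Module.finrank ℝ (LinearMap.range (f : Ambient n →ₗ[ℝ] ℝ)) = 1 := by
    have := range_eq_top_of_ne_zero hf
    rw [show LinearMap.range (f : Ambient n →ₗ[ℝ] ℝ) = ⊤ from this]
    simp
  rw [h2] at h
  simp at h
  have h3 : Module.finrank ℝ (LinearMap.ker (f : Ambient n →ₗ[ℝ] ℝ)) = n := by omega
  exact h3

/-- Near each of its points a hypersurface is parametrized by its tangent space, by a map which is
strictly differentiable at the origin with the inclusion as its derivative. -/
theorem exists_chart (hS : IsSmoothHypersurface S) (hp : p ∈ S) :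
    Module.finrank ℝ (tangentSpace S p) = n ∧ ∃ G : tangentSpace S p → Ambient n,
      G 0 = p ∧ HasStrictFDerivAt G (tangentSpace S p).subtypeL 0 ∧ (∀ᶠ a in 𝓝 0, G a ∈ S) ∧
        ∀ V ∈ 𝓝 (0 : tangentSpace S p), G '' V ∈ 𝓝[S] p := by
  obtain ⟨U, hU, hpU, u, hu, hdu, hSU⟩ := hS p hp
  have huS : ∀ x ∈ S, x ∈ U → u x = 0 := fun x h1 h2 => (hSU.subset ⟨h1, h2⟩).2
  have hup : u p = 0 := huS p hp hpU
  have hs : HasStrictFDerivAt u (fderiv ℝ u p) p :=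
    (hu.contDiffAt (hU.mem_nhds hpU)).hasStrictFDerivAt (by simp)
  have hr : (fderiv ℝ u p).range = ⊤ := range_eq_top_of_ne_zero (hdu p hpU)
  set G := hs.implicitFunction u (fderiv ℝ u p) hr 0 with hG
  have hG0 : G 0 = p := by
    have := hs.implicitFunction_apply_image hr
    rwa [hup] at this
  have hGd : HasStrictFDerivAt G (fderiv ℝ u p).ker.subtypeL 0 := by
    have := hs.to_implicitFunction hr
    rwa [hup] at this
  have hGc : Tendsto G (𝓝 0) (𝓝 p) := by
    have := hGd.continuousAt.tendsto
    rwa [hG0] at this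
  have hGS : ∀ᶠ a in 𝓝 0, G a ∈ S := by
    have h1 := hs.map_implicitFunction_eq hr
    rw [hup, nhds_prod_eq] at h1
    have h2 : ∀ᶠ a in 𝓝 0, u (G a) = 0 :=
      (tendsto_const_nhds.prodMk tendsto_id : Tendsto (fun a : (fderiv ℝ u p).ker => ((0 : ℝ), a))
        (𝓝 0) (𝓝 0 ×ˢ 𝓝 0)).eventually h1
    filter_upwards [h2, hGc.eventually (hU.mem_nhds hpU)] with a h3 h4
    exact (hSU.symm.subset ⟨h4, h3⟩).1
  have hsub : ∀ V ∈ 𝓝 (0 : (fderiv ℝ u p).ker), G '' V ∈ 𝓝[S] p := by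
    intro V hV
    have h1 := hs.eq_implicitFunction hr
    have h2 : Tendsto (fun x => (hs.implicitToOpenPartialHomeomorph u (fderiv ℝ u p) hr x).snd)
        (𝓝 p) (𝓝 0) := by
      have h3 := (hs.implicitToOpenPartialHomeomorph u (fderiv ℝ u p) hr).continuousAt
        (hs.mem_implicitToOpenPartialHomeomorph_source hr)
      have h4 := (continuous_snd.continuousAt.comp h3).tendsto
      simpa [Function.comp_def] using h4
    have h5 := h2.eventually hV
    filter_upwards [self_mem_nhdsWithin, mem_nhdsWithin_of_mem_nhds h1,
      mem_nhdsWithin_of_mem_nhds h5, mem_nhdsWithin_of_mem_nhds (hU.mem_nhds hpU)]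
      with x hxS hx1 hx2 hxU
    refine ⟨_, hx2, ?_⟩
    rw [huS x hxS hxU] at hx1
    exact hx1
  -- A kernel vector `v` is the limit of `k (G (v / k) - p)`, hence lies in the tangent cone;
  -- conversely `u` vanishes on `S`.
  have hker : (fderiv ℝ u p).ker = tangentSpace S p := by
    apply le_antisymm
    · intro v hv
      refine Submodule.subset_span ?_
      let v' : (fderiv ℝ u p).ker := ⟨v, hv⟩
      let c : ℕ → ℝ := fun k => k
      have hc : Tendsto (fun k => ‖c k‖) atTop atTop := by
        simpa [c] using tendsto_natCast_atTop_atTop (R := ℝ)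
      have hcv : Tendsto (fun k => (c k)⁻¹ • v') atTop (𝓝 0) := by
        simpa using (tendsto_natCast_atTop_atTop (R := ℝ)).inv_tendsto_atTop.smul_const v'
      refine mem_tangentConeAt_of_seq atTop c (fun k => G ((c k)⁻¹ • v') - p) ?_ ?_ ?_
      · simpa using (hGc.comp hcv).sub_const p
      · filter_upwards [hcv.eventually hGS] with k hk
        simpa using hk
      · simpa [hG0] using hGd.hasFDerivAt.lim v' hc
    · intro v hv
      exact eq_zero_of_mem_tangentSpace_of_eqOn hs.hasFDerivAt hp
        (by filter_upwards [self_mem_nhdsWithin, mem_nhdsWithin_of_mem_nhds (hU.mem_nhds hpU)]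
              with x h1 h2 using huS x h1 h2) hv
  clear_value G
  refine ⟨hker ▸ finrank_ker_of_ne_zero (hdu p hpU), ?_⟩
  rw [← hker]
  exact ⟨G, hG0, hGd, hGS, hsub⟩

theorem finrank_tangentSpace (hS : IsSmoothHypersurface S) (hp : p ∈ S) :
    Module.finrank ℝ (tangentSpace S p) = n := (exists_chart hS hp).1

/-- The chart of `exists_chart` distorts distances near the origin by a factor of at most `2`. -/
theorem exists_chart_bilipschitz (hS : IsSmoothHypersurface S) (hp : p ∈ S) :
    ∃ G : tangentSpace S p → Ambient n, G 0 = p ∧ ∃ ρ > 0, MapsTo G (ball 0 ρ) S ∧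
      (∀ a ∈ ball 0 ρ, ∀ b ∈ ball 0 ρ, dist (G a) (G b) ≤ 2 * dist a b) ∧
      (∀ a ∈ ball 0 ρ, ∀ b ∈ ball 0 ρ, dist a b ≤ 2 * dist (G a) (G b)) ∧
        ∀ r > 0, G '' (ball 0 r) ∈ 𝓝[S] p := by
  obtain ⟨-, G, hG0, hGd, hGS, hsub⟩ := exists_chart hS hp
  -- The derivative is an isometric inclusion, so an error of `1/2` keeps the distortion between
  -- `1/2` and `3/2`.
  obtain ⟨s, hs, hA⟩ := hGd.approximates_deriv_on_nhds (c := 1 / 2) (Or.inr (by norm_num))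
  obtain ⟨ρ, hρ, hball⟩ := Metric.mem_nhds_iff.1 (inter_mem hs hGS)
  have key : ∀ a ∈ ball (0 : tangentSpace S p) ρ, ∀ b ∈ ball (0 : tangentSpace S p) ρ,
      |dist (G a) (G b) - dist a b| ≤ 1 / 2 * dist a b := by
    intro a ha b hb
    have h1 := hA a (hball ha).1 b (hball hb).1
    have h2 := abs_norm_sub_norm_le (G a - G b) ((tangentSpace S p).subtypeL (a - b))
    rw [dist_eq_norm, dist_eq_norm]
    simp only [Submodule.subtypeL_apply, NNReal.coe_div, NNReal.coe_one, NNReal.coe_ofNat,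
      Submodule.coe_norm] at h1 h2 ⊢
    exact h2.trans h1
  refine ⟨G, hG0, ρ, hρ, fun a ha => (hball ha).2, fun a ha b hb => ?_, fun a ha b hb => ?_,
    fun r hr => hsub _ (ball_mem_nhds _ hr)⟩
  · have h := abs_le.1 (key a ha b hb)
    linarith [h.2, dist_nonneg (x := a) (y := b)]
  · have h := abs_le.1 (key a ha b hb)
    linarith [h.1, dist_nonneg (x := a) (y := b)]

/-- A hypersurface is relatively closed where a defining function lives, though perhaps not
globally. This local compactness feeds Hopf-Rinow, the smoothing and measurability. -/
theorem exists_isCompact_inter_closedBall (hS : IsSmoothHypersurface S) (hp : p ∈ S) :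
    ∃ r > 0, ∀ r' ≤ r, IsCompact (S ∩ closedBall p r') := by
  obtain ⟨U, hU, hpU, u, hu, -, hSU⟩ := hS p hp
  obtain ⟨r, hr, hrU⟩ := Metric.nhds_basis_closedBall.mem_iff.1 (hU.mem_nhds hpU)
  refine ⟨r, hr, fun r' hr' => ?_⟩
  have hsub : closedBall p r' ⊆ U := (closedBall_subset_closedBall hr').trans hrU
  have : S ∩ closedBall p r' = closedBall p r' ∩ u ⁻¹' {0} := by
    ext x
    constructor
    · rintro ⟨h1, h2⟩
      exact ⟨h2, (hSU.subset ⟨h1, hsub h2⟩).2⟩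
    · rintro ⟨h1, h2⟩
      exact ⟨(hSU.symm.subset ⟨hsub h1, h2⟩).1, h1⟩
  rw [this]
  exact (isCompact_closedBall p r').of_isClosed_subset
    ((hu.continuousOn.mono hsub).preimage_isClosed_of_isClosed isClosed_closedBall
      isClosed_singleton) inter_subset_left

/-- The inverse chart is `2`-Lipschitz, so an image of measure zero would force a ball of the
tangent space to have measure zero. -/
theorem hausdorffMeasure_inter_ball_pos (hS : IsSmoothHypersurface S) (hp : p ∈ S) {r : ℝ}
    (hr : 0 < r) : 0 < μHE[n] (S ∩ ball p r) := by
  obtain ⟨G, hG0, ρ, hρ, hGS, hG1, hG2, -⟩ := exists_chart_bilipschitz hS hp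
  have hn := finrank_tangentSpace hS hp
  set V : Set (tangentSpace S p) := ball 0 (min ρ (r / 2)) with hV
  have hVρ : V ⊆ ball 0 ρ := ball_subset_ball (min_le_left _ _)
  have hsub : G '' V ⊆ S ∩ ball p r := by
    rintro _ ⟨a, ha, rfl⟩
    refine ⟨hGS (hVρ ha), ?_⟩
    have h1 := hG1 a (hVρ ha) 0 (mem_ball_self hρ)
    have h2 : dist a 0 < r / 2 := (mem_ball.1 ha).trans_le (min_le_right _ _)
    rw [hG0] at h1
    rw [mem_ball]
    linarith
  refine lt_of_lt_of_le ?_ (measure_mono hsub)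
  have hVpos : 0 < μHE[n] V := by
    have h1 : 0 < (μHE[Module.finrank ℝ (tangentSpace S p)] : Measure (tangentSpace S p)) V :=
      measure_ball_pos _ _ (lt_min hρ (by linarith))
    rwa [hn] at h1
  have hinj : InjOn G V := fun a ha b hb hab => by
    have := hG2 a (hVρ ha) b (hVρ hb)
    rw [hab, dist_self, mul_zero] at this
    exact dist_le_zero.1 this
  have himg : Function.invFunOn G V '' (G '' V) = V := by
    rw [image_image]
    exact (image_congr fun a ha => hinj.leftInvOn_invFunOn ha).trans (image_id' V)
  have hlip : LipschitzOnWith 2 (Function.invFunOn G V) (G '' V) := by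
    refine LipschitzOnWith.of_dist_le_mul ?_
    rintro _ ⟨a, ha, rfl⟩ _ ⟨b, hb, rfl⟩
    rw [hinj.leftInvOn_invFunOn ha, hinj.leftInvOn_invFunOn hb]
    exact hG2 a (hVρ ha) b (hVρ hb)
  have hle := hlip.hausdorffMeasure_image_le (d := n) (Nat.cast_nonneg n)
  rw [himg] at hle
  rw [Measure.euclideanHausdorffMeasure_def] at hVpos ⊢
  simp only [Measure.smul_apply, ENNReal.smul_def, smul_eq_mul] at hVpos ⊢
  rw [ENNReal.mul_pos_iff] at hVpos ⊢
  refine ⟨hVpos.1, pos_iff_ne_zero.2 fun h => ?_⟩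
  rw [h, mul_zero] at hle
  exact absurd hVpos.2 (not_lt.2 hle)

end Chart

/-! ### Frames and projections -/

section Frame

variable {E : Type*} [NormedAddCommGroup E] [InnerProductSpace ℝ E]
  {ι κ : Type*} [Fintype ι] [Fintype κ] {T : Submodule ℝ E} [T.HasOrthogonalProjection]

/-- Both sides are the squared norm of the projection of `u` to `T`. This trades an arbitrarily
chosen frame of `T` for a fixed ambient basis. -/
theorem sum_inner_sq_eq_sum_inner_starProjection_sq (b : OrthonormalBasis ι ℝ T)
    (e : OrthonormalBasis κ ℝ E) (u : E) :
    ∑ i, inner ℝ u (b i : E) ^ 2 = ∑ a, inner ℝ u (T.starProjection (e a)) ^ 2 := by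
  have h1 : ∀ i, inner ℝ u (b i : E) = inner ℝ (b i) (T.orthogonalProjectionOnto u) := fun i => by
    rw [real_inner_comm]
    exact (Submodule.inner_orthogonalProjectionOnto_eq_of_mem_left (b i) u).symm
  have h2 : ∀ a, inner ℝ u (T.starProjection (e a)) = inner ℝ (e a) (T.starProjection u) := fun a => by
    rw [real_inner_comm, Submodule.inner_starProjection_left_eq_right]
  simp only [h1, h2]
  have h3 := b.sum_sq_norm_inner_right (T.orthogonalProjectionOnto u)
  have h4 := e.sum_sq_norm_inner_right (T.starProjection u)
  simp only [Real.norm_eq_abs, sq_abs] at h3 h4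
  rw [h3, h4]
  rfl

theorem sum_inner_map_sq_eq_sum_starProjection [CompleteSpace E] (b : OrthonormalBasis ι ℝ T)
    (e : OrthonormalBasis κ ℝ E) (M : E →L[ℝ] E) :
    ∑ i, ∑ j, inner ℝ (M (b i)) (b j : E) ^ 2 =
      ∑ a, ∑ c, inner ℝ (M (T.starProjection (e c))) (T.starProjection (e a)) ^ 2 := by
  simp only [sum_inner_sq_eq_sum_inner_starProjection_sq b e]
  rw [Finset.sum_comm]
  refine Finset.sum_congr rfl fun a _ => ?_
  have h : ∀ v, inner ℝ (M v) (T.starProjection (e a)) =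
      inner ℝ (ContinuousLinearMap.adjoint M (T.starProjection (e a))) v := fun v => by
    rw [ContinuousLinearMap.adjoint_inner_left, real_inner_comm]
  simp only [h]
  exact sum_inner_sq_eq_sum_inner_starProjection_sq b e _

end Frame

/-! ### Unit normals, the second fundamental form and the gradient -/

section Normal

variable {n : ℕ} {S : Set (Ambient n)} {p : Ambient n}

/-- A derivative within `S` is determined only on the span of the tangent cone, which is all the
gradient sees. -/
theorem eq_of_hasFDerivWithinAt_of_mem_tangentSpace {f : Ambient n → ℝ} {A B : Ambient n →L[ℝ] ℝ}
    (hA : HasFDerivWithinAt f A S p) (hB : HasFDerivWithinAt f B S p) {v : Ambient n}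
    (hv : v ∈ tangentSpace S p) : A v = B v := by
  have hle : tangentSpace S p ≤ LinearMap.ker ((A - B : Ambient n →L[ℝ] ℝ) : Ambient n →ₗ[ℝ] ℝ) :=
    Submodule.span_le.2 fun w hw => by simpa [sub_eq_zero] using hA.unique_on hB hw
  simpa [sub_eq_zero] using hle hv

theorem exists_smul_of_mem_orthogonal (hS : IsSmoothHypersurface S) (hp : p ∈ S)
    {ν w : Ambient n} (h1 : ‖ν‖ = 1) (hν : ν ∈ (tangentSpace S p)ᗮ)
    (hw : w ∈ (tangentSpace S p)ᗮ) : w = inner ℝ ν w • ν := by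
  have hdim : Module.finrank ℝ (tangentSpace S p)ᗮ = 1 := by
    have h := Submodule.finrank_add_finrank_orthogonal (tangentSpace S p)
    rw [finrank_tangentSpace hS hp] at h
    simpa using h
  have hν0 : (⟨ν, hν⟩ : (tangentSpace S p)ᗮ) ≠ 0 := fun h => by
    have : ν = 0 := congrArg Subtype.val h
    simp [this] at h1
  obtain ⟨c, hc⟩ := (finrank_eq_one_iff_of_nonzero' _ hν0).1 hdim ⟨w, hw⟩
  have hc' : c • ν = w := congrArg Subtype.val hc
  rw [← hc', inner_smul_right, real_inner_self_eq_norm_sq, h1]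
  simp

theorem starProjection_tangentSpace (hS : IsSmoothHypersurface S) (hp : p ∈ S)
    {ν : Ambient n} (h1 : ‖ν‖ = 1) (hν : ν ∈ (tangentSpace S p)ᗮ) (w : Ambient n) :
    (tangentSpace S p).starProjection w = w - inner ℝ ν w • ν := by
  have h2 : w - (tangentSpace S p).starProjection w ∈ (tangentSpace S p)ᗮ :=
    Submodule.sub_starProjection_mem_orthogonal w
  have h3 := exists_smul_of_mem_orthogonal hS hp h1 hν h2
  have h4 : inner ℝ ν ((tangentSpace S p).starProjection w) = 0 :=
    Submodule.inner_left_of_mem_orthogonal (Submodule.starProjection_apply_mem _ w) hν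
  rw [inner_sub_right, h4, sub_zero] at h3
  rw [← h3]
  abel

theorem isUnitNormalNear_localNormal (hS : IsSmoothHypersurface S) (hp : p ∈ S) :
    IsUnitNormalNear S p (localNormal S p) :=
  Classical.epsilon_spec (exists_isUnitNormalNear hS hp)

/-- Unit normals agree up to a locally constant sign. -/
theorem exists_sign_of_isUnitNormalNear (hS : IsSmoothHypersurface S) (hp : p ∈ S)
    {ν ν' : Ambient n → Ambient n} (hν : IsUnitNormalNear S p ν) (hν' : IsUnitNormalNear S p ν') :
    ∃ σ : ℝ, σ ^ 2 = 1 ∧ ∀ᶠ y in 𝓝[S] p, ν' y = σ • ν y := by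
  obtain ⟨U, hU, hpU, hc, hn⟩ := hν
  obtain ⟨U', hU', hpU', hc', hn'⟩ := hν'
  have hex : ∀ y ∈ S, y ∈ U → y ∈ U' → ν' y = inner ℝ (ν y) (ν' y) • ν y := fun y hy h h' =>
    exists_smul_of_mem_orthogonal hS hy (hn y ⟨hy, h⟩).1 (hn y ⟨hy, h⟩).2 (hn' y ⟨hy, h'⟩).2
  have hsq : ∀ y ∈ S, y ∈ U → y ∈ U' → inner ℝ (ν y) (ν' y) ^ 2 = 1 := fun y hy h h' => by
    have h1 := congrArg norm (hex y hy h h')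
    rw [norm_smul, (hn y ⟨hy, h⟩).1, (hn' y ⟨hy, h'⟩).1, mul_one, Real.norm_eq_abs] at h1
    rw [← sq_abs, ← h1, one_pow]
  have hcont : ContinuousAt (fun y => inner ℝ (ν y) (ν' y)) p :=
    (hc.continuousOn.continuousAt (hU.mem_nhds hpU)).inner
      (hc'.continuousOn.continuousAt (hU'.mem_nhds hpU'))
  refine ⟨inner ℝ (ν p) (ν' p), hsq p hp hpU hpU', ?_⟩
  filter_upwards [self_mem_nhdsWithin, mem_nhdsWithin_of_mem_nhds (hU.mem_nhds hpU),
    mem_nhdsWithin_of_mem_nhds (hU'.mem_nhds hpU'),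
    mem_nhdsWithin_of_mem_nhds (hcont (ball_mem_nhds _ one_pos))] with y hy h h' hb
  rw [hex y hy h h']
  congr 1
  have h1 := hsq y hy h h'
  have h2 := hsq p hp hpU hpU'
  -- Both inner products are `±1`, so being less than `1` apart they coincide.
  have h3 : |inner ℝ (ν y) (ν' y) - inner ℝ (ν p) (ν' p)| < 1 := hb
  rcases sq_eq_sq_iff_eq_or_eq_neg.1 (h1.trans h2.symm) with h4 | h4
  · exact h4
  · rw [h4] at h3
    nlinarith [abs_lt.1 h3]

theorem continuousAt_sub_inner_smul {ν : Ambient n → Ambient n} (h : ContinuousAt ν p)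
    (w : Ambient n) : ContinuousAt (fun x => w - inner ℝ (ν x) w • ν x) p :=
  continuousAt_const.sub (ContinuousAt.smul (f := fun x => inner ℝ (ν x) w)
    (h.inner continuousAt_const) h)

/-- `|A|²` in terms of an arbitrary smooth unit normal field. -/
theorem secondFundamentalFormNormSq_eq (hS : IsSmoothHypersurface S) (hp : p ∈ S)
    {ν : Ambient n → Ambient n} (hν : IsUnitNormalNear S p ν) :
    secondFundamentalFormNormSq S p = ∑ a, ∑ c, inner ℝ
      (fderiv ℝ ν p ((tangentSpace S p).starProjection (EuclideanSpace.basisFun _ ℝ c)))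
      ((tangentSpace S p).starProjection (EuclideanSpace.basisFun _ ℝ a)) ^ 2 := by
  rw [← sum_inner_map_sq_eq_sum_starProjection (tangentFrame S p)]
  have hν' := isUnitNormalNear_localNormal hS hp
  obtain ⟨σ, hσ, h⟩ := exists_sign_of_isUnitNormalNear hS hp hν hν'
  obtain ⟨U, hU, hpU, hc, -⟩ := hν
  obtain ⟨U', hU', hpU', hc', -⟩ := hν'
  have hd := ((hc.contDiffAt (hU.mem_nhds hpU)).differentiableAt (by simp)).hasFDerivAt
  have hd' := ((hc'.contDiffAt (hU'.mem_nhds hpU')).differentiableAt (by simp)).hasFDerivAt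
  -- The two fields are related only along `S`, so their differentials are compared on tangent
  -- vectors only.
  have hv : ∀ v ∈ tangentSpace S p, fderiv ℝ (localNormal S p) p v = σ • fderiv ℝ ν p v := by
    intro v hv
    have := eq_zero_of_mem_tangentSpace_of_eqOn (hd'.sub (hd.const_smul σ)) hp
      (h.mono fun y hy => by simp [hy]) hv
    simpa [sub_eq_zero] using this
  unfold secondFundamentalFormNormSq secondFundamentalForm
  refine Finset.sum_congr rfl fun i _ => Finset.sum_congr rfl fun j _ => ?_
  rw [hv _ (tangentFrame S p i).2, inner_smul_left]
  simp only [conj_trivial]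
  rw [neg_sq, mul_pow, hσ, one_mul]

theorem continuousOn_secondFundamentalFormNormSq (hS : IsSmoothHypersurface S) :
    ContinuousOn (secondFundamentalFormNormSq S) S := by
  intro p hp
  obtain ⟨ν, U, hU, hpU, hc, hn⟩ := exists_isUnitNormalNear hS hp
  have hcont : ContinuousAt (fun x => ∑ a, ∑ c, inner ℝ
      (fderiv ℝ ν x (EuclideanSpace.basisFun _ ℝ c -
        inner ℝ (ν x) (EuclideanSpace.basisFun (Fin (n + 1)) ℝ c) • ν x))
      (EuclideanSpace.basisFun _ ℝ a -
        inner ℝ (ν x) (EuclideanSpace.basisFun (Fin (n + 1)) ℝ a) • ν x) ^ 2) p := by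
    have h1 : ContinuousAt ν p := hc.continuousOn.continuousAt (hU.mem_nhds hpU)
    have h2 : ContinuousAt (fderiv ℝ ν) p :=
      (hc.continuousOn_fderiv_of_isOpen hU (by simp)).continuousAt (hU.mem_nhds hpU)
    have h3 := continuousAt_sub_inner_smul h1
    exact tendsto_finsetSum _ fun a _ => tendsto_finsetSum _ fun c _ =>
      (((h2.clm_apply (h3 _)).inner (h3 _)).pow 2)
  refine hcont.continuousWithinAt.congr_of_eventuallyEq_of_mem ?_ hp
  filter_upwards [self_mem_nhdsWithin, mem_nhdsWithin_of_mem_nhds (hU.mem_nhds hpU)] with x hx hxU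
  rw [secondFundamentalFormNormSq_eq hS hx ⟨U, hU, hxU, hc, hn⟩]
  simp only [starProjection_tangentSpace hS hx (hn x ⟨hx, hxU⟩).1 (hn x ⟨hx, hxU⟩).2]

theorem secondFundamentalFormNormSq_nonneg (S : Set (Ambient n)) (p : Ambient n) :
    0 ≤ secondFundamentalFormNormSq S p :=
  Finset.sum_nonneg fun _ _ => Finset.sum_nonneg fun _ _ => sq_nonneg _

theorem inner_tangentialGradient {g : Ambient n → ℝ} (hg : DifferentiableAt ℝ g p)
    (v : tangentSpace S p) :
    inner ℝ (tangentialGradient S g p) v = fderiv ℝ g p v := by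
  rw [tangentialGradient, InnerProductSpace.toDual_symm_apply]
  exact eq_of_hasFDerivWithinAt_of_mem_tangentSpace
    hg.differentiableWithinAt.hasFDerivWithinAt hg.hasFDerivAt.hasFDerivWithinAt v.2

theorem norm_tangentialGradient_le {g : Ambient n → ℝ} (hg : DifferentiableAt ℝ g p) :
    ‖tangentialGradient S g p‖ ≤ ‖fderiv ℝ g p‖ := by
  rcases eq_or_ne ‖tangentialGradient S g p‖ 0 with h | h
  · rw [h]; exact norm_nonneg _
  · have h1 := inner_tangentialGradient hg (tangentialGradient S g p)
    have h2 := (le_abs_self _).trans ((fderiv ℝ g p).le_opNorm (tangentialGradient S g p))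
    rw [← h1, real_inner_self_eq_norm_mul_norm, Submodule.coe_norm] at h2
    exact le_of_mul_le_mul_right h2 (lt_of_le_of_ne (norm_nonneg _) h.symm)

theorem norm_tangentialGradient_sq {g : Ambient n → ℝ} (hg : DifferentiableAt ℝ g p) :
    ‖tangentialGradient S g p‖ ^ 2 = ∑ a,
      fderiv ℝ g p ((tangentSpace S p).starProjection (EuclideanSpace.basisFun _ ℝ a)) ^ 2 := by
  have h := sum_inner_sq_eq_sum_inner_starProjection_sq (tangentFrame S p)
    (EuclideanSpace.basisFun _ ℝ) ((InnerProductSpace.toDual ℝ (Ambient n)).symm (fderiv ℝ g p))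
  simp only [InnerProductSpace.toDual_symm_apply] at h
  rw [← h, ← (tangentFrame S p).sum_sq_norm_inner_left]
  simp only [inner_tangentialGradient hg, Real.norm_eq_abs, sq_abs]

theorem continuousOn_norm_tangentialGradient_sq (hS : IsSmoothHypersurface S)
    {g : Ambient n → ℝ} (hg : ContDiff ℝ ∞ g) :
    ContinuousOn (fun x => ‖tangentialGradient S g x‖ ^ 2) S := by
  intro p hp
  obtain ⟨ν, U, hU, hpU, hc, hn⟩ := exists_isUnitNormalNear hS hp
  have hcont : ContinuousAt (fun x => ∑ a, fderiv ℝ g x (EuclideanSpace.basisFun _ ℝ a -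
        inner ℝ (ν x) (EuclideanSpace.basisFun (Fin (n + 1)) ℝ a) • ν x) ^ 2) p := by
    have h1 : ContinuousAt ν p := hc.continuousOn.continuousAt (hU.mem_nhds hpU)
    have h2 : ContinuousAt (fderiv ℝ g) p := (hg.continuous_fderiv (by simp)).continuousAt
    exact tendsto_finsetSum _ fun a _ => (h2.clm_apply
      (continuousAt_sub_inner_smul h1 _)).pow 2
  refine hcont.continuousWithinAt.congr_of_eventuallyEq_of_mem ?_ hp
  filter_upwards [self_mem_nhdsWithin, mem_nhdsWithin_of_mem_nhds (hU.mem_nhds hpU)] with x hx hxU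
  rw [norm_tangentialGradient_sq (hg.differentiable (by simp) x)]
  simp only [starProjection_tangentSpace hS hx (hn x ⟨hx, hxU⟩).1 (hn x ⟨hx, hxU⟩).2]

end Normal

/-! ### The Hopf-Rinow theorem for length spaces -/

open scoped NNReal in
/-- In a complete locally compact space in which points at distance less than `r + s` are joined
through a point at distances at most `r` and `s`, bounded closed balls are compact. -/
theorem isCompact_closedEBall_of_length {X : Type*} [PseudoEMetricSpace X] [CompleteSpace X]
    [WeaklyLocallyCompactSpace X]
    (hlen : ∀ (x y : X) (r s : ℝ≥0), edist x y < r + s → ∃ z, edist x z ≤ r ∧ edist z y ≤ s)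
    (p : X) (R : ℝ≥0) : IsCompact (closedEBall p R) := by
  -- The radii with compact balls form an initial segment, closed under suprema by completeness and
  -- without a largest element by local compactness; hence it contains every radius.
  set A : Set ℝ≥0 := {r | IsCompact (closedEBall p (r : ℝ≥0∞))} with hA
  have hlow : ∀ r ∈ A, ∀ s ≤ r, s ∈ A := fun r hr s hs =>
    hr.of_isClosed_subset isClosed_closedEBall (closedEBall_subset_closedEBall (by exact_mod_cast hs))
  have hclosed : ∀ r : ℝ≥0, (∀ s < r, s ∈ A) → r ∈ A := by
    intro r hr
    refine isCompact_iff_totallyBounded_isComplete.2 ⟨?_, isClosed_closedEBall.isComplete⟩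
    rw [EMetric.totallyBounded_iff]
    intro ε hε
    obtain ⟨δ, hδ, hδε⟩ : ∃ δ : ℝ≥0, 0 < δ ∧ (δ : ℝ≥0∞) < ε := by
      simpa using ENNReal.lt_iff_exists_nnreal_btwn.1 hε
    have hδ3 : 0 < δ / 3 := by positivity
    rcases le_or_gt r (δ / 3) with hrδ | hrδ
    · refine ⟨{p}, finite_singleton p, fun y hy => ?_⟩
      have h1 : (r : ℝ≥0∞) ≤ δ := by exact_mod_cast hrδ.trans (div_le_self zero_le (by norm_num))
      simpa using (mem_closedEBall.1 hy).trans_lt (h1.trans_lt hδε)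
    · have hs : r - δ / 3 < r := tsub_lt_self (hδ3.trans hrδ) hδ3
      obtain ⟨t, -, htf, ht⟩ := EMetric.totallyBounded_iff'.1 (hr _ hs).totallyBounded (δ / 3 : ℝ≥0)
        (by exact_mod_cast hδ3)
      refine ⟨t, htf, fun y hy => ?_⟩
      -- `hlen` needs a strict inequality, hence `2δ/3` and not `δ/3`; with the `δ/3`-net of the
      -- smaller ball this totals `δ`.
      have h1 : edist p y < (r - δ / 3 : ℝ≥0) + (2 * (δ / 3) : ℝ≥0) := by
        refine (mem_closedEBall'.1 hy).trans_lt ?_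
        have : r < (r - δ / 3) + 2 * (δ / 3) := by
          rw [two_mul, ← add_assoc, tsub_add_cancel_of_le hrδ.le]
          exact lt_add_of_pos_right _ hδ3
        exact_mod_cast this
      obtain ⟨z, hz1, hz2⟩ := hlen p y _ _ h1
      obtain ⟨w, hw, hzw⟩ := mem_iUnion₂.1 (ht (mem_closedEBall'.2 hz1))
      refine mem_iUnion₂.2 ⟨w, hw, lt_of_le_of_lt ?_ hδε⟩
      calc edist y w ≤ edist y z + edist z w := edist_triangle _ _ _
        _ ≤ (2 * (δ / 3) : ℝ≥0) + (δ / 3 : ℝ≥0) := by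
            rw [edist_comm y z]; exact add_le_add hz2 (mem_eball.1 hzw).le
        _ = δ := by
            rw [← ENNReal.coe_add]; congr 1; ring
  have hopen : ∀ r ∈ A, ∃ s ∈ A, r < s := by
    intro r hr
    obtain ⟨K, hK, hrK⟩ := exists_compact_superset (show IsCompact (closedEBall p (r : ℝ≥0∞)) from hr)
    obtain ⟨δ, hδ, hδK⟩ := IsCompact.exists_cthickening_subset_open
      (show IsCompact (closedEBall p (r : ℝ≥0∞)) from hr) isOpen_interior hrK
    have hδ' : 0 < δ.toNNReal := Real.toNNReal_pos.2 hδ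
    refine ⟨r + δ.toNNReal / 2, ?_, lt_add_of_pos_right _ (half_pos hδ')⟩
    refine hK.of_isClosed_subset isClosed_closedEBall fun y hy => interior_subset (hδK ?_)
    have h1 : edist p y < r + δ.toNNReal := by
      refine (mem_closedEBall'.1 hy).trans_lt ?_
      exact_mod_cast add_lt_add_right (half_lt_self hδ') r
    obtain ⟨z, hz1, hz2⟩ := hlen p y _ _ h1
    exact mem_cthickening_of_edist_le y z δ _ (mem_closedEBall'.2 hz1) (by rw [edist_comm]; exact hz2)
  by_contra hR
  have hbdd : BddAbove A := ⟨R, fun r hr => le_of_not_gt fun h => hR (hlow r hr R h.le)⟩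
  have h0 : (0 : ℝ≥0) ∈ A := hclosed 0 fun s hs => absurd hs not_lt_zero
  have hsup : sSup A ∈ A := hclosed _ fun s hs => by
    obtain ⟨a, ha, hsa⟩ := exists_lt_of_lt_csSup ⟨0, h0⟩ hs
    exact hlow a ha s hsa.le
  obtain ⟨s, hs, hlt⟩ := hopen _ hsup
  exact absurd (le_csSup hbdd hs) (not_le.2 hlt)

/-! ### The intrinsic distance -/

section Intrinsic

variable {n : ℕ} {S : Set (Ambient n)}

theorem intrinsicEDist_le {γ : ℝ → Ambient n} (hc : ContinuousOn γ (Icc 0 1))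
    (hm : MapsTo γ (Icc 0 1) S) : intrinsicEDist S (γ 0) (γ 1) ≤ eVariationOn γ (Icc 0 1) :=
  iInf_le (fun γ' : {γ' : ℝ → Ambient n // ContinuousOn γ' (Icc 0 1) ∧ MapsTo γ' (Icc 0 1) S ∧
    γ' 0 = γ 0 ∧ γ' 1 = γ 1} => eVariationOn γ'.1 (Icc 0 1)) ⟨γ, hc, hm, rfl, rfl⟩

/-- Length does not increase under a monotone reparametrization, so curves need not live on the unit
interval. -/
theorem intrinsicEDist_le_eVariationOn {γ : ℝ → Ambient n} {a b : ℝ} (hab : a ≤ b)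
    (hc : ContinuousOn γ (Icc a b)) (hm : MapsTo γ (Icc a b) S) :
    intrinsicEDist S (γ a) (γ b) ≤ eVariationOn γ (Icc a b) := by
  let φ : ℝ → ℝ := fun t => a + t * (b - a)
  have hφ : MapsTo φ (Icc 0 1) (Icc a b) := fun t ht => by
    constructor <;> simp only [φ] <;> nlinarith [ht.1, ht.2]
  have hφm : MonotoneOn φ (Icc 0 1) := fun s _ t _ hst => by
    simp only [φ]; nlinarith
  have hφc : Continuous φ := by fun_prop
  have h := (intrinsicEDist_le (hc.comp hφc.continuousOn hφ) (hm.comp hφ)).trans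
    (eVariationOn.comp_le_of_monotoneOn γ φ hφm hφ)
  have h0 : φ 0 = a := by simp [φ]
  have h1 : φ 1 = b := by simp [φ]
  rwa [Function.comp_apply, Function.comp_apply, h0, h1] at h

theorem intrinsicEDist_self {x : Ambient n} (hx : x ∈ S) : intrinsicEDist S x x = 0 := by
  have h := intrinsicEDist_le_eVariationOn (S := S) (γ := fun _ => x) zero_le_one
    continuousOn_const fun _ _ => hx
  rw [eVariationOn.constant_on] at h
  · exact le_antisymm h zero_le
  · exact subsingleton_singleton.anti (image_subset_iff.2 fun _ _ => rfl)

theorem intrinsicEDist_comm (x y : Ambient n) : intrinsicEDist S x y = intrinsicEDist S y x := by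
  suffices h : ∀ x y, intrinsicEDist S x y ≤ intrinsicEDist S y x from le_antisymm (h x y) (h y x)
  intro x y
  refine le_iInf fun ⟨γ, hc, hm, h0, h1⟩ => ?_
  let φ : ℝ → ℝ := fun t => 1 - t
  have hφ : MapsTo φ (Icc 0 1) (Icc 0 1) := fun t ht =>
    ⟨by simp only [φ]; linarith [ht.2], by simp only [φ]; linarith [ht.1]⟩
  have hφc : Continuous φ := by fun_prop
  have h := (intrinsicEDist_le (hc.comp hφc.continuousOn hφ) (hm.comp hφ)).trans
    (eVariationOn.comp_le_of_antitoneOn γ φ (fun s _ t _ hst => by simp only [φ]; linarith) hφ)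
  have e0 : φ 0 = 1 := by simp [φ]
  have e1 : φ 1 = 0 := by simp [φ]
  rwa [Function.comp_apply, Function.comp_apply, e0, e1, h0, h1] at h

theorem edist_le_intrinsicEDist (x y : Ambient n) : edist x y ≤ intrinsicEDist S x y := by
  refine le_iInf fun ⟨γ, hc, hm, h0, h1⟩ => ?_
  have h := eVariationOn.edist_le γ (left_mem_Icc.2 zero_le_one) (right_mem_Icc.2 zero_le_one)
  rwa [h0, h1] at h

theorem intrinsicEDist_triangle (x y z : Ambient n) :
    intrinsicEDist S x z ≤ intrinsicEDist S x y + intrinsicEDist S y z := by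
  conv_rhs => unfold intrinsicEDist
  refine ENNReal.le_iInf_add_iInf fun ⟨γ, hc, hm, h0, h1⟩ ⟨γ', hc', hm', h0', h1'⟩ => ?_
  let φ : ℝ → Ambient n := fun t => if t ≤ 1 then γ t else γ' (t - 1)
  have e1 : EqOn φ γ (Icc 0 1) := fun t ht => if_pos ht.2
  have e2 : EqOn φ (γ' ∘ fun t => t - 1) (Icc 1 2) := fun t ht => by
    rcases ht.1.eq_or_lt with rfl | h
    · simp [φ, h1, h0']
    · simp [φ, not_le.2 h]
  have hshift : MapsTo (fun t : ℝ => t - 1) (Icc 1 2) (Icc 0 1) := fun t ht =>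
    ⟨by linarith [ht.1], by linarith [ht.2]⟩
  have hun : Icc (0 : ℝ) 1 ∪ Icc 1 2 = Icc 0 2 := Icc_union_Icc_eq_Icc (by norm_num) (by norm_num)
  have hφc : ContinuousOn φ (Icc 0 2) := by
    rw [← hun]
    exact (hc.congr e1).union_of_isClosed
      ((hc'.comp (by fun_prop) hshift).congr e2) isClosed_Icc isClosed_Icc
  have hφm : MapsTo φ (Icc 0 2) S := by
    rw [← hun]
    exact (hm.congr e1.symm).union ((hm'.comp hshift).congr e2.symm)
  have h := intrinsicEDist_le_eVariationOn (by norm_num) hφc hφm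
  have hx : φ 0 = x := by simp [φ, h0]
  have hz : φ 2 = z := by
    have : ¬ (2 : ℝ) ≤ 1 := by norm_num
    simp only [φ, if_neg this, ← h1']
    norm_num
  rw [hx, hz] at h
  refine h.trans ?_
  have hadd := eVariationOn.Icc_add_Icc φ (s := univ) (zero_le_one : (0 : ℝ) ≤ 1)
    (one_le_two : (1 : ℝ) ≤ 2) (mem_univ _)
  simp only [univ_inter] at hadd
  rw [← hadd, eVariationOn.congr e1, eVariationOn.congr e2]
  gcongr
  exact eVariationOn.comp_le_of_monotoneOn γ' _ (fun s _ t _ hst => by simpa using hst) hshift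

/-- The intrinsic distance is locally comparable to the ambient distance. -/
theorem exists_intrinsicEDist_le (hS : IsSmoothHypersurface S) {p : Ambient n} (hp : p ∈ S) :
    ∃ r > 0, ∀ x ∈ S ∩ ball p r, ∀ y ∈ S ∩ ball p r,
      intrinsicEDist S x y ≤ ENNReal.ofReal (4 * dist x y) := by
  obtain ⟨G, -, ρ, hρ, hGS, hG1, hG2, hG3⟩ := exists_chart_bilipschitz hS hp
  obtain ⟨r, hr, hrG⟩ := mem_nhdsWithin_iff.1 (hG3 ρ hρ)
  refine ⟨r, hr, fun x hx y hy => ?_⟩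
  obtain ⟨a, ha, rfl⟩ := hrG hx.symm
  obtain ⟨b, hb, rfl⟩ := hrG hy.symm
  have hmem : MapsTo (AffineMap.lineMap a b : ℝ → tangentSpace S p) (Icc 0 1) (ball 0 ρ) :=
    -- The competing curve is the chart image of a segment; the chart and its inverse each cost a
    -- factor `2`, whence `4`.
    fun t ht => (convex_ball _ _).lineMap_mem ha hb ht
  set γ : ℝ → Ambient n := fun t => G (AffineMap.lineMap a b t) with hγ
  have hlip : LipschitzOnWith (2 * nndist a b) γ (Icc 0 1) := by
    refine LipschitzOnWith.of_dist_le_mul fun s hs t ht => ?_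
    refine (hG1 _ (hmem hs) _ (hmem ht)).trans (le_of_eq ?_)
    rw [dist_lineMap_lineMap]
    simp only [NNReal.coe_mul, NNReal.coe_ofNat, coe_nndist]
    ring
  have h := intrinsicEDist_le_eVariationOn zero_le_one hlip.continuousOn (hGS.comp hmem)
  have h0 : γ 0 = G a := by simp [hγ]
  have h1 : γ 1 = G b := by simp [hγ]
  rw [h0, h1] at h
  refine h.trans ((hlip.comp_eVariationOn_le (g := id) (mapsTo_id _)).trans ?_)
  have hid : eVariationOn (id : ℝ → ℝ) (Icc 0 1) = 1 := by simp
  rw [hid, mul_one, ← ENNReal.ofReal_coe_nnreal]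
  refine ENNReal.ofReal_le_ofReal ?_
  simp only [NNReal.coe_mul, NNReal.coe_ofNat, coe_nndist]
  linarith [hG2 a ha b hb]

/-- The hypersurface `S` with its intrinsic distance. -/
structure IntrinsicSpace (S : Set (Ambient n)) : Type where
  point : Ambient n
  mem : point ∈ S

noncomputable instance (S : Set (Ambient n)) : PseudoEMetricSpace (IntrinsicSpace S) where
  edist x y := intrinsicEDist S x.1 y.1
  edist_self x := intrinsicEDist_self x.2
  edist_comm x y := intrinsicEDist_comm x.1 y.1
  edist_triangle x y z := intrinsicEDist_triangle x.1 y.1 z.1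

theorem IntrinsicSpace.edist_def (x y : IntrinsicSpace S) :
    edist x y = intrinsicEDist S x.1 y.1 := rfl

theorem continuous_intrinsicSpace_val : Continuous fun x : IntrinsicSpace S => (x.1 : Ambient n) :=
  LipschitzWith.continuous (K := 1) fun x y => by
    simpa [IntrinsicSpace.edist_def] using edist_le_intrinsicEDist x.1 y.1

theorem continuous_toIntrinsicSpace (hS : IsSmoothHypersurface S) :
    Continuous fun x : S => (⟨x.1, x.2⟩ : IntrinsicSpace S) := by
  refine continuous_iff_continuousAt.2 fun p => ?_
  obtain ⟨r, hr, h⟩ := exists_intrinsicEDist_le hS p.2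
  refine tendsto_iff_edist_tendsto_0.2 ?_
  have h1 : Tendsto (fun x : S => ENNReal.ofReal (4 * dist (x : Ambient n) p)) (𝓝 p) (𝓝 0) := by
    have : Continuous fun x : S => ENNReal.ofReal (4 * dist (x : Ambient n) p) :=
      ENNReal.continuous_ofReal.comp (by fun_prop)
    simpa using this.tendsto p
  refine tendsto_of_tendsto_of_tendsto_of_le_of_le' tendsto_const_nhds h1
    (Eventually.of_forall fun _ => zero_le) ?_
  filter_upwards [continuous_subtype_val.continuousAt.preimage_mem_nhds (ball_mem_nhds p.1 hr)]
    with x hx using h x ⟨x.2, hx⟩ p ⟨p.2, mem_ball_self hr⟩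

/-- The intrinsic distance induces the topology of `S`. -/
noncomputable def intrinsicSpaceHomeomorph (hS : IsSmoothHypersurface S) : S ≃ₜ IntrinsicSpace S where
  toFun x := ⟨x.1, x.2⟩
  invFun x := ⟨x.1, x.2⟩
  left_inv _ := rfl
  right_inv _ := rfl
  continuous_toFun := continuous_toIntrinsicSpace hS
  continuous_invFun := continuous_intrinsicSpace_val.subtype_mk _

theorem weaklyLocallyCompactSpace_intrinsicSpace (hS : IsSmoothHypersurface S) :
    WeaklyLocallyCompactSpace (IntrinsicSpace S) := by
  have : WeaklyLocallyCompactSpace S := ⟨fun p => by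
    obtain ⟨r, hr, h⟩ := exists_isCompact_inter_closedBall hS p.2
    refine ⟨Subtype.val ⁻¹' closedBall p.1 r, ?_,
      continuous_subtype_val.continuousAt.preimage_mem_nhds (closedBall_mem_nhds _ hr)⟩
    rw [Subtype.isCompact_iff, Subtype.image_preimage_coe]
    exact h r le_rfl⟩
  exact (intrinsicSpaceHomeomorph hS).symm.isClosedEmbedding.weaklyLocallyCompactSpace

theorem completeSpace_intrinsicSpace (hS : IsIntrinsicallyComplete S) :
    CompleteSpace (IntrinsicSpace S) := by
  refine EMetric.complete_of_cauchySeq_tendsto fun x hx => ?_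
  obtain ⟨y, hy, h⟩ := hS (fun k => (x k).1) (fun k => (x k).2) fun ε hε =>
    EMetric.cauchySeq_iff.1 hx ε hε
  exact ⟨⟨y, hy⟩, tendsto_iff_edist_tendsto_0.2 h⟩

open scoped NNReal in
-- On a curve shorter than `r + s`, the intermediate value theorem finds a point at distance exactly
-- `r` from `x`. The arc before it has length at least `r`, leaving less than `s`.
theorem exists_edist_le_of_edist_lt_add (hS : IsSmoothHypersurface S) (x y : IntrinsicSpace S)
    (r s : ℝ≥0) (h : edist x y < r + s) : ∃ z, edist x z ≤ r ∧ edist z y ≤ s := by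
  rcases le_or_gt (edist x y) r with hxy | hxy
  · exact ⟨y, hxy, by simp⟩
  obtain ⟨⟨γ, hc, hm, h0, h1⟩, hγ⟩ := iInf_lt_iff.1 h
  simp only at hγ
  have hd : ContinuousOn (fun t => intrinsicEDist S x.1 (γ t)) (Icc 0 1) := by
    rw [continuousOn_iff_continuous_domRestrict]
    have h2 : Continuous fun t : Icc (0 : ℝ) 1 => (⟨γ t, hm t.2⟩ : S) :=
      (continuousOn_iff_continuous_domRestrict.1 hc).subtype_mk _
    exact (continuous_const (y := x)).edist ((continuous_toIntrinsicSpace hS).comp h2)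
  obtain ⟨t, ht, htr⟩ := intermediate_value_Icc zero_le_one hd
    (show (r : ℝ≥0∞) ∈ Icc _ _ by
      rw [h0, h1, intrinsicEDist_self x.2]
      exact ⟨zero_le, hxy.le⟩)
  refine ⟨⟨γ t, hm ht⟩, htr.le, ?_⟩
  have h01 : Icc 0 t ⊆ Icc 0 1 := Icc_subset_Icc_right ht.2
  have h12 : Icc t 1 ⊆ Icc 0 1 := Icc_subset_Icc_left ht.1
  have l1 := intrinsicEDist_le_eVariationOn ht.1 (hc.mono h01) (hm.mono_left h01)
  have l2 := intrinsicEDist_le_eVariationOn ht.2 (hc.mono h12) (hm.mono_left h12)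
  have hadd := eVariationOn.Icc_add_Icc γ (s := univ) ht.1 ht.2 (mem_univ _)
  simp only [univ_inter] at hadd
  rw [h0] at l1
  rw [h1] at l2
  simp only at htr
  rw [htr] at l1
  have h3 : (r : ℝ≥0∞) + intrinsicEDist S (γ t) y.1 < r + s :=
    lt_of_le_of_lt (add_le_add l1 l2) (hadd.symm ▸ hγ)
  exact ((ENNReal.add_lt_add_iff_left ENNReal.coe_ne_top).1 h3).le

/-- Intrinsically bounded closed balls of an intrinsically complete hypersurface are compact. -/
theorem isCompact_setOf_intrinsicEDist_le (hS : IsSmoothHypersurface S)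
    (hc : IsIntrinsicallyComplete S) {p : Ambient n} (hp : p ∈ S) (R : NNReal) :
    IsCompact {x ∈ S | intrinsicEDist S p x ≤ R} := by
  have := weaklyLocallyCompactSpace_intrinsicSpace hS
  have := completeSpace_intrinsicSpace hc
  have h := (isCompact_closedEBall_of_length (exists_edist_le_of_edist_lt_add hS)
    (⟨p, hp⟩ : IntrinsicSpace S) R).image continuous_intrinsicSpace_val
  convert h using 1
  ext x
  constructor
  · rintro ⟨hx, h⟩
    exact ⟨⟨x, hx⟩, mem_closedEBall'.2 h, rfl⟩
  · rintro ⟨y, hy, rfl⟩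
    exact ⟨y.2, mem_closedEBall'.1 hy⟩

end Intrinsic

/-! ### Smoothing of Lipschitz functions -/

section Smoothing

open scoped NNReal Manifold

variable {E : Type*} [NormedAddCommGroup E] [NormedSpace ℝ E] [FiniteDimensional ℝ E]

/-- Mollification: a Lipschitz function is uniformly close to a smooth one with the same Lipschitz
constant. -/
theorem _root_.LipschitzWith.exists_contDiff_dist_le {f : E → ℝ} {C : ℝ≥0} (hf : LipschitzWith C f)
    {ε : ℝ} (hε : 0 < ε) :
    ∃ g : E → ℝ, ContDiff ℝ ∞ g ∧ LipschitzWith C g ∧ ∀ x, dist (g x) (f x) ≤ ε := by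
  borelize E
  let μ : Measure E := Measure.addHaar
  have hC : (0 : ℝ) < C + 1 := by positivity
  -- The `+ 1` covers `C = 0`. Averaging against a kernel of mass one preserves the Lipschitz
  -- constant.
  let φ : ContDiffBump (0 : E) := ⟨ε / (C + 1) / 2, ε / (C + 1), by positivity,
    half_lt_self (by positivity)⟩
  have hφc : Continuous (φ.normed μ) := φ.continuous_normed
  have hφs : HasCompactSupport (φ.normed μ) := φ.hasCompactSupport_normed
  refine ⟨convolution (φ.normed μ) f (ContinuousLinearMap.lsmul ℝ ℝ) μ, ?_, ?_, fun x => ?_⟩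
  · exact hφs.contDiff_convolution_left _ φ.contDiff_normed hf.continuous.locallyIntegrable
  · refine LipschitzWith.of_dist_le_mul fun x y => ?_
    have hint : ∀ z, Integrable (fun t => φ.normed μ t * f (z - t)) μ := fun z =>
      (hφc.mul (hf.continuous.comp (by fun_prop))).integrable_of_hasCompactSupport hφs.mul_right
    simp only [convolution, ContinuousLinearMap.lsmul_apply, smul_eq_mul]
    rw [dist_eq_norm, ← integral_sub (hint x) (hint y)]
    refine (norm_integral_le_of_norm_le (g := fun t => φ.normed μ t * (C * dist x y))
      (φ.integrable_normed.mul_const _) (Eventually.of_forall fun t => ?_)).trans ?_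
    · rw [← mul_sub, norm_mul, Real.norm_of_nonneg (φ.nonneg_normed t), ← dist_eq_norm]
      refine mul_le_mul_of_nonneg_left ?_ (φ.nonneg_normed t)
      simpa using hf.dist_le_mul (x - t) (y - t)
    · rw [integral_mul_const, φ.integral_normed, one_mul]
  · refine φ.dist_normed_convolution_le hf.continuous.aestronglyMeasurable fun y hy => ?_
    have h1 : dist y x < ε / (C + 1) := hy
    calc dist (f y) (f x) ≤ C * dist y x := hf.dist_le_mul y x
      _ ≤ (C + 1) * (ε / (C + 1)) := by gcongr; linarith
      _ = ε := by field_simp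

/-- A function on a locally compact set `S` that vanishes off a compact set and is locally
`C`-Lipschitz is uniformly close to a smooth function with compact support in `S` whose
differential along `S` is hardly larger than `C`. -/
theorem exists_contDiff_approx_of_locally_lipschitz {S K : Set E} (hK : IsCompact K) (hKS : K ⊆ S)
    (hloc : ∀ p ∈ S, ∃ r > 0, ∀ r' ≤ r, IsCompact (S ∩ closedBall p r')) {φ : E → ℝ} {C : ℝ≥0}
    (hφ : ∀ x ∈ S \ K, φ x = 0) (hlip : ∀ p ∈ S, ∃ r > 0, LipschitzOnWith C φ (S ∩ ball p r))
    {η : ℝ} (hη : 0 < η) :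
    ∃ g : E → ℝ, ContDiff ℝ ∞ g ∧ (∃ K' ⊆ S, IsCompact K' ∧ ∀ x ∈ S \ K', g x = 0) ∧
      (∀ x ∈ S, |g x - φ x| ≤ η) ∧ ∀ x ∈ S, ‖fderiv ℝ g x‖ ≤ C + η := by
  have hr : ∀ p ∈ S, ∃ r > 0, IsCompact (S ∩ closedBall p r) ∧
      LipschitzOnWith C φ (S ∩ ball p r) := by
    intro p hp
    obtain ⟨r₁, h₁, hc⟩ := hloc p hp
    obtain ⟨r₂, h₂, hl⟩ := hlip p hp
    exact ⟨min r₁ r₂, lt_min h₁ h₂, hc _ (min_le_left _ _),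
      hl.mono (inter_subset_inter_right _ (ball_subset_ball (min_le_right _ _)))⟩
  choose! r hr0 hrc hrl using hr
  obtain ⟨t, htK, htc⟩ := hK.elim_nhds_subcover (fun p => ball p (r p))
    fun p hp => ball_mem_nhds p (hr0 p (hKS hp))
  obtain ⟨χ, hχ⟩ := SmoothPartitionOfUnity.exists_isSubordinate (𝓘(ℝ, E)) hK.isClosed
    (fun i : t => ball (i : E) (r i)) (fun _ => isOpen_ball)
    (htc.trans fun x hx => by simpa using hx)
  have htS : ∀ i : t, (i : E) ∈ S := fun i => hKS (htK i i.2)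
  have hχs : ∀ i, ContDiff ℝ ∞ (χ i) := fun i => (χ i).contMDiff.contDiff
  have hχd : ∀ i, Differentiable ℝ (χ i) := fun i => (hχs i).differentiable (by simp)
  have hχc : ∀ i, HasCompactSupport (χ i) := fun i =>
    (isCompact_closedBall (i : E) (r i)).of_isClosed_subset (isClosed_tsupport _)
      ((hχ i).trans ball_subset_closedBall)
  have hM : ∀ i, ∃ M : ℝ, ∀ x, ‖fderiv ℝ (χ i) x‖ ≤ M := fun i =>
    ((hχs i).continuous_fderiv (by simp)).bounded_above_of_compact_support ((hχc i).fderiv ℝ)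
  choose M hM using hM
  have hM0 : ∀ i, 0 ≤ M i := fun i => (norm_nonneg _).trans (hM i 0)
  have hMs : 0 ≤ ∑ i, M i := Finset.sum_nonneg fun i _ => hM0 i
  set δ : ℝ := η / (1 + ∑ i, M i) with hδ
  have hδ0 : 0 < δ := by positivity
  have hδη : δ * (1 + ∑ i, M i) = η := by rw [hδ]; field_simp
  -- Each local piece of `φ` is extended to all of `E` with the same constant, then mollified.
  have hext : ∀ i : t, ∃ g : E → ℝ, ContDiff ℝ ∞ g ∧ LipschitzWith C g ∧
      ∀ x ∈ S ∩ ball (i : E) (r i), |g x - φ x| ≤ δ := by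
    intro i
    obtain ⟨f, hf, hfe⟩ := (hrl i (htS i)).extend_real
    obtain ⟨g, hg, hgl, hgf⟩ := hf.exists_contDiff_dist_le hδ0
    exact ⟨g, hg, hgl, fun x hx => by rw [hfe hx]; exact hgf x⟩
  choose g hg hgl hgφ using hext
  have hgd : ∀ i, Differentiable ℝ (g i) := fun i => (hg i).differentiable (by simp)
  have hsum : ∀ x ∈ K, ∑ i, χ i x = 1 := fun x hx => by
    rw [← finsum_eq_sum_of_fintype]; exact χ.sum_eq_one hx
  have hsum_le : ∀ x, ∑ i, χ i x ≤ 1 := fun x => by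
    rw [← finsum_eq_sum_of_fintype]; exact χ.sum_le_one x
  have hχgφ : ∀ x ∈ S, ∀ i, χ i x * |g i x - φ x| ≤ χ i x * δ := by
    intro x hx i
    rcases eq_or_ne (χ i x) 0 with h | h
    · simp [h]
    · exact mul_le_mul_of_nonneg_left (hgφ i x ⟨hx, hχ i (subset_tsupport _ h)⟩) (χ.nonneg i x)
  have hdχgφ : ∀ x ∈ S, ∀ i, |g i x - φ x| * ‖fderiv ℝ (χ i) x‖ ≤ δ * M i := by
    intro x hx i
    rcases eq_or_ne (fderiv ℝ (χ i) x) 0 with h | h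
    · rw [h, norm_zero, mul_zero]; exact mul_nonneg hδ0.le (hM0 i)
    · have hxi : x ∈ tsupport (χ i) := tsupport_fderiv_subset ℝ (subset_tsupport _ h)
      exact mul_le_mul (hgφ i x ⟨hx, hχ i hxi⟩) (hM i x) (norm_nonneg _) hδ0.le
  refine ⟨fun x => ∑ i, χ i x * g i x, ContDiff.sum fun i _ => (hχs i).mul (hg i),
    ⟨⋃ i, S ∩ tsupport (χ i), iUnion_subset fun i => inter_subset_left,
      isCompact_iUnion fun i => ?_, fun x hx => ?_⟩, fun x hx => ?_, fun x hx => ?_⟩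
  · have : S ∩ tsupport (χ i) = (S ∩ closedBall (i : E) (r i)) ∩ tsupport (χ i) := by
      rw [inter_assoc, inter_eq_self_of_subset_right ((hχ i).trans ball_subset_closedBall)]
    rw [this]
    exact (hrc i (htS i)).inter_right (isClosed_tsupport _)
  · refine Finset.sum_eq_zero fun i _ => ?_
    have : x ∉ tsupport (χ i) := fun h => hx.2 (mem_iUnion.2 ⟨i, hx.1, h⟩)
    rw [image_eq_zero_of_notMem_tsupport this, zero_mul]
  · have h0 : φ x * (∑ i, χ i x - 1) = 0 := by
      by_cases hxK : x ∈ K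
      · rw [hsum x hxK, sub_self, mul_zero]
      · rw [hφ x ⟨hx, hxK⟩, zero_mul]
    have h1 : ∑ i, χ i x * g i x - φ x = ∑ i, χ i x * (g i x - φ x) := by
      have : ∑ i, χ i x * (g i x - φ x) = ∑ i, χ i x * g i x - φ x * ∑ i, χ i x := by
        rw [Finset.mul_sum, ← Finset.sum_sub_distrib]
        exact Finset.sum_congr rfl fun i _ => by ring
      rw [this]
      linear_combination h0
    rw [h1]
    calc |∑ i, χ i x * (g i x - φ x)| ≤ ∑ i, |χ i x * (g i x - φ x)| := Finset.abs_sum_le_sum_abs _ _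
      _ ≤ ∑ i, χ i x * δ := Finset.sum_le_sum fun i _ => by
          rw [abs_mul, abs_of_nonneg (χ.nonneg i x)]; exact hχgφ x hx i
      _ = (∑ i, χ i x) * δ := by rw [Finset.sum_mul]
      _ ≤ 1 * δ := by gcongr; exact hsum_le x
      _ ≤ η := by rw [one_mul, ← hδη]; nlinarith
  -- Off `K`, `φ` vanishes; on `K`, the sum of the `χ i` attains its maximum `1`. So `φ x` may be
  -- subtracted from each `g i x` in the terms with `fderiv (χ i)`, making them `O(δ)`.
  · have h0 : φ x • ∑ i, fderiv ℝ (χ i) x = 0 := by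
      by_cases hxK : x ∈ K
      · have hmax : IsLocalMax (fun y => ∑ i, χ i y) x :=
          Eventually.of_forall fun y => by simpa only [hsum x hxK] using hsum_le y
        have h := hmax.fderiv_eq_zero
        rw [fderiv_fun_sum fun i _ => (hχd i) x] at h
        rw [h, smul_zero]
      · rw [hφ x ⟨hx, hxK⟩, zero_smul]
    have h1 : fderiv ℝ (fun y => ∑ i, χ i y * g i y) x =
        ∑ i, χ i x • fderiv ℝ (g i) x + ∑ i, (g i x - φ x) • fderiv ℝ (χ i) x := by
      have : ∑ i, (g i x - φ x) • fderiv ℝ (χ i) x =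
          ∑ i, g i x • fderiv ℝ (χ i) x - φ x • ∑ i, fderiv ℝ (χ i) x := by
        rw [Finset.smul_sum, ← Finset.sum_sub_distrib]
        exact Finset.sum_congr rfl fun i _ => sub_smul _ _ _
      rw [this, h0, sub_zero, ← Finset.sum_add_distrib,
        fderiv_fun_sum fun i _ => ((hχd i).fun_mul (hgd i)) x]
      exact Finset.sum_congr rfl fun i _ => fderiv_fun_mul (hχd i x) (hgd i x)
    rw [h1]
    have hA : ‖∑ i, χ i x • fderiv ℝ (g i) x‖ ≤ C := by
      calc ‖∑ i, χ i x • fderiv ℝ (g i) x‖ ≤ ∑ i, χ i x * C :=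
            norm_sum_le_of_le _ fun i _ => by
              rw [norm_smul, Real.norm_of_nonneg (χ.nonneg i x)]
              exact mul_le_mul_of_nonneg_left (norm_fderiv_le_of_lipschitz ℝ (hgl i))
                (χ.nonneg i x)
        _ = (∑ i, χ i x) * C := by rw [Finset.sum_mul]
        _ ≤ 1 * C := by gcongr; exact hsum_le x
        _ = C := one_mul _
    have hB : ‖∑ i, (g i x - φ x) • fderiv ℝ (χ i) x‖ ≤ η := by
      calc ‖∑ i, (g i x - φ x) • fderiv ℝ (χ i) x‖ ≤ ∑ i, δ * M i :=
            norm_sum_le_of_le _ fun i _ => by rw [norm_smul]; exact hdχgφ x hx i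
        _ = δ * ∑ i, M i := by rw [Finset.mul_sum]
        _ ≤ η := by rw [← hδη]; nlinarith
    exact (norm_add_le _ _).trans (add_le_add hA hB)

end Smoothing

/-! ### Cut-off functions -/

section Cutoff

variable {n : ℕ} {S : Set (Ambient n)}

/-- An intrinsically complete hypersurface has cut-off functions with small gradient. -/
theorem exists_cutoff (hS : IsSmoothHypersurface S) (hc : IsIntrinsicallyComplete S)
    {p : Ambient n} (hp : p ∈ S) : ∃ r₀ > 0, ∀ ε > 0, ∃ g : Ambient n → ℝ, ContDiff ℝ ∞ g ∧
      (∃ K ⊆ S, IsCompact K ∧ ∀ x ∈ S \ K, g x = 0) ∧ (∀ x ∈ S ∩ ball p r₀, 1 / 4 ≤ g x) ∧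
        ∀ x ∈ S, ‖fderiv ℝ g x‖ ≤ ε := by
  obtain ⟨r₀, hr₀, hp₀⟩ := exists_intrinsicEDist_le hS hp
  refine ⟨r₀, hr₀, fun ε hε => ?_⟩
  -- `8 r₀ ≤ R` makes `φ ≥ 1/2` on the ball, and `4 / R` is the local Lipschitz constant of `φ`;
  -- smoothing then costs at most `1/4` in value and `ε/2` in gradient.
  obtain ⟨R, hR, hRr, hRε⟩ : ∃ R : NNReal, 0 < R ∧ 8 * r₀ ≤ R ∧ 4 / R ≤ ε / 2 := by
    have h : 0 < 8 * r₀ + 8 / ε := by positivity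
    refine ⟨⟨8 * r₀ + 8 / ε, h.le⟩, h, ?_, ?_⟩
    · change 8 * r₀ ≤ 8 * r₀ + 8 / ε
      linarith [div_pos (by norm_num : (0 : ℝ) < 8) hε]
    · change 4 / (8 * r₀ + 8 / ε) ≤ ε / 2
      rw [div_le_iff₀ h]
      have : ε / 2 * (8 * r₀ + 8 / ε) = 4 * ε * r₀ + 4 := by field_simp; ring
      rw [this]
      linarith [mul_pos hε hr₀]
  have hR' : (0 : ℝ) < R := hR
  -- Truncating before `toReal` matters: the distance is `∞` to points not joined to `p`, and
  -- `toReal` would send it to `0`.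
  set F : Ambient n → ℝ := fun x => (min (intrinsicEDist S p x) R).toReal with hF
  have hFR : ∀ x, R < intrinsicEDist S p x → F x = R := fun x hx => by simp [hF, min_eq_right hx.le]
  have hFle : ∀ x y, F x ≤ F y + (intrinsicEDist S y x).toReal ∨ intrinsicEDist S y x = ⊤ := by
    intro x y
    refine or_iff_not_imp_right.2 fun hxy => ?_
    have hfin : min (intrinsicEDist S p y) R ≠ ⊤ := (min_le_right _ _).trans_lt ENNReal.coe_lt_top |>.ne
    rw [hF, ← ENNReal.toReal_add hfin hxy]
    refine ENNReal.toReal_mono (ENNReal.add_ne_top.2 ⟨hfin, hxy⟩) ?_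
    rcases le_total (intrinsicEDist S p y) R with h | h
    · rw [min_eq_left h]
      exact (min_le_left _ _).trans (intrinsicEDist_triangle _ _ _)
    · rw [min_eq_right h]
      exact (min_le_right _ _).trans le_self_add
  set φ : Ambient n → ℝ := fun x => 1 - F x / R with hφ
  obtain ⟨g, hg, hgK, hgφ, hgd⟩ := exists_contDiff_approx_of_locally_lipschitz
    (isCompact_setOf_intrinsicEDist_le hS hc hp R) (fun x hx => hx.1)
    (fun q hq => exists_isCompact_inter_closedBall hS hq) (φ := φ) (C := 4 / R)
    (fun x hx => by
      have : R < intrinsicEDist S p x := lt_of_not_ge fun h => hx.2 ⟨hx.1, h⟩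
      simp only [hφ, hFR x this]
      field_simp
      ring)
    (fun q hq => by
      obtain ⟨r, hr, h⟩ := exists_intrinsicEDist_le hS hq
      refine ⟨r, hr, LipschitzOnWith.of_le_add_mul _ fun x hx y hy => ?_⟩
      have h1 : F y ≤ F x + 4 * dist x y := by
        rcases hFle y x with h2 | h2
        · refine h2.trans (add_le_add le_rfl ?_)
          exact ENNReal.toReal_le_of_le_ofReal (by positivity) (h x hx y hy)
        · exact absurd (h x hx y hy) (h2 ▸ not_le.2 ENNReal.ofReal_lt_top)
      have h3 : F y / R ≤ F x / R + 4 / R * dist x y := by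
        rw [div_mul_eq_mul_div, ← add_div]
        gcongr
      simp only [hφ, NNReal.coe_div, NNReal.coe_ofNat]
      linarith)
    (η := min (1 / 4) (ε / 2)) (lt_min (by norm_num) (by positivity))
  refine ⟨g, hg, hgK, fun x hx => ?_, fun x hx => (hgd x hx).trans ?_⟩
  · have h1 : F x ≤ 4 * r₀ := by
      refine ENNReal.toReal_le_of_le_ofReal (by positivity) ((min_le_left _ _).trans ?_)
      refine (hp₀ p ⟨hp, mem_ball_self hr₀⟩ x hx).trans (ENNReal.ofReal_le_ofReal ?_)
      have : dist x p < r₀ := hx.2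
      rw [dist_comm]
      linarith
    have h2 : F x / R ≤ 1 / 2 := by
      rw [div_le_iff₀ hR']
      linarith
    have h3 := (abs_le.1 ((hgφ x hx.1).trans (min_le_left _ _))).1
    simp only [hφ] at h3
    linarith
  · have := min_le_right (1 / 4) (ε / 2)
    simp only [NNReal.coe_div, NNReal.coe_ofNat]
    linarith

end Cutoff

/-! ### The Gaussian weighted volume -/

section Volume

variable {n : ℕ} {S : Set (Ambient n)}

/-- By the Lindelöf property, `S` is a countable union of compact pieces. -/
theorem measurableSet_of_isSmoothHypersurface (hS : IsSmoothHypersurface S) : MeasurableSet S := by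
  have h : ∀ p ∈ S, ∃ r > 0, IsCompact (S ∩ closedBall p r) := fun p hp => by
    obtain ⟨r, hr, h⟩ := exists_isCompact_inter_closedBall hS hp
    exact ⟨r, hr, h r le_rfl⟩
  choose! r hr hc using h
  obtain ⟨t, htS, ht, hcov⟩ := TopologicalSpace.countable_cover_nhdsWithin (s := S)
    (f := fun p => closedBall p (r p))
    fun p hp => mem_nhdsWithin_of_mem_nhds (closedBall_mem_nhds p (hr p hp))
  have : S = ⋃ p ∈ t, S ∩ closedBall p (r p) := by
    rw [← inter_iUnion₂]
    exact (inter_eq_self_of_subset_left hcov).symm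
  rw [this]
  exact MeasurableSet.biUnion ht fun p hp => (hc p (htS hp)).measurableSet

theorem measure_lt_top_of_isCompact (hV : HasPolynomialVolumeGrowth S) {K : Set (Ambient n)}
    (hK : IsCompact K) (hKS : K ⊆ S) : μHE[n] K < ⊤ := by
  obtain ⟨C, d, h⟩ := hV
  obtain ⟨r, hr⟩ := hK.isBounded.subset_ball 0
  refine (measure_mono (subset_inter (hr.trans (ball_subset_ball (le_max_left r 1))) hKS)).trans_lt
    ((h _ (le_max_right r 1)).trans_lt ENNReal.ofReal_lt_top)

theorem integrableOn_of_continuousOn (hS : IsSmoothHypersurface S)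
    (hV : HasPolynomialVolumeGrowth S) {F : Ambient n → ℝ} (hF : ContinuousOn F S)
    {K : Set (Ambient n)} (hK : IsCompact K) (hKS : K ⊆ S) (h0 : ∀ x ∈ S \ K, F x = 0) :
    IntegrableOn F S μHE[n] := by
  obtain ⟨M, hM⟩ := hK.exists_bound_of_continuousOn (hF.mono hKS)
  have h1 : IntegrableOn F K μHE[n] :=
    IntegrableOn.of_bound (measure_lt_top_of_isCompact hV hK hKS)
      ((hF.mono hKS).aestronglyMeasurable hK.measurableSet) M
      ((ae_restrict_iff' hK.measurableSet).2 (Eventually.of_forall hM))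
  exact h1.of_forall_sdiff_eq_zero (measurableSet_of_isSmoothHypersurface hS) h0

theorem summable_exp_neg_sq_mul_rpow (C d : ℝ) :
    Summable fun k : ℕ => Real.exp (-(k : ℝ) ^ 2 / 4) * (|C| * ((k : ℝ) + 1) ^ d) := by
  have h1 := (summable_nat_add_iff 1).2
    (Real.summable_pow_mul_exp_neg_nat_mul ⌈d⌉₊ (r := 1 / 2) (by norm_num))
  refine Summable.of_nonneg_of_le (fun k => by positivity) (fun k => ?_)
    (h1.mul_left (Real.exp (3 / 4) * |C|))
  -- The exponents compare by `(k - 1)² ≥ 0`.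
  have h2 : Real.exp (-(k : ℝ) ^ 2 / 4) ≤
      Real.exp (3 / 4) * Real.exp (-(1 / 2) * ((k + 1 : ℕ) : ℝ)) := by
    rw [← Real.exp_add]
    refine Real.exp_le_exp.2 ?_
    push_cast
    nlinarith [sq_nonneg ((k : ℝ) - 1)]
  have h3 : ((k : ℝ) + 1) ^ d ≤ ((k + 1 : ℕ) : ℝ) ^ ⌈d⌉₊ := by
    rw [← Real.rpow_natCast, Nat.cast_add_one]
    exact Real.rpow_le_rpow_of_exponent_le (by linarith [Nat.cast_nonneg (α := ℝ) k]) (Nat.le_ceil d)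
  calc Real.exp (-(k : ℝ) ^ 2 / 4) * (|C| * ((k : ℝ) + 1) ^ d)
      ≤ (Real.exp (3 / 4) * Real.exp (-(1 / 2) * ((k + 1 : ℕ) : ℝ))) *
        (|C| * ((k + 1 : ℕ) : ℝ) ^ ⌈d⌉₊) := by gcongr
    _ = _ := by ring

/-- The Gaussian weighted volume is finite under polynomial volume growth. -/
theorem integrableOn_gaussian (hV : HasPolynomialVolumeGrowth S) :
    IntegrableOn (fun x => Real.exp (-‖x‖ ^ 2 / 4)) S μHE[n] := by
  obtain ⟨C, d, h⟩ := hV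
  have hcont : Continuous fun x : Ambient n => Real.exp (-‖x‖ ^ 2 / 4) := by fun_prop
  refine ⟨hcont.aestronglyMeasurable, ?_⟩
  rw [hasFiniteIntegral_iff_ofReal (Eventually.of_forall fun x => (Real.exp_pos _).le)]
  -- On each unit shell the weight is bounded at the inner radius and the volume at the outer one.
  let A : ℕ → Set (Ambient n) := fun k => (ball 0 (k + 1) ∩ S) ∩ {x | (k : ℝ) ≤ ‖x‖}
  have hA : S ⊆ ⋃ k, A k := fun x hx => mem_iUnion.2
    ⟨⌊‖x‖⌋₊, ⟨by simpa using Nat.lt_floor_add_one ‖x‖, hx⟩, Nat.floor_le (norm_nonneg x)⟩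
  have hle : ∀ k, ∫⁻ x in A k, ENNReal.ofReal (Real.exp (-‖x‖ ^ 2 / 4)) ∂μHE[n] ≤
      ENNReal.ofReal (Real.exp (-(k : ℝ) ^ 2 / 4) * (|C| * ((k : ℝ) + 1) ^ d)) := by
    intro k
    have h1 : ∀ x ∈ A k, ENNReal.ofReal (Real.exp (-‖x‖ ^ 2 / 4)) ≤
        ENNReal.ofReal (Real.exp (-(k : ℝ) ^ 2 / 4)) := fun x hx => by
      have : (k : ℝ) ≤ ‖x‖ := hx.2
      gcongr
    refine (setLIntegral_mono measurable_const h1).trans ?_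
    rw [setLIntegral_const, ENNReal.ofReal_mul (Real.exp_pos _).le]
    gcongr
    refine (measure_mono inter_subset_left).trans ((h (k + 1) (by simp)).trans ?_)
    gcongr
    exact le_abs_self C
  calc ∫⁻ x in S, ENNReal.ofReal (Real.exp (-‖x‖ ^ 2 / 4)) ∂μHE[n]
      ≤ ∫⁻ x in ⋃ k, A k, ENNReal.ofReal (Real.exp (-‖x‖ ^ 2 / 4)) ∂μHE[n] := lintegral_mono_set hA
    _ ≤ ∑' k, ∫⁻ x in A k, ENNReal.ofReal (Real.exp (-‖x‖ ^ 2 / 4)) ∂μHE[n] :=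
        lintegral_iUnion_le _ _
    _ ≤ ∑' k : ℕ, ENNReal.ofReal (Real.exp (-(k : ℝ) ^ 2 / 4) * (|C| * ((k : ℝ) + 1) ^ d)) :=
        ENNReal.tsum_le_tsum hle
    _ < ⊤ := (summable_exp_neg_sq_mul_rpow C d).tsum_ofReal_lt_top

/-- A cut-off function with gradient at most `ε` has Rayleigh numerator at most
`ε² V - D / 2`, where `V` is the Gaussian volume of `S` and `D` is the Rayleigh denominator. -/
theorem gaussianIntegral_rayleigh_le (hS : IsSmoothHypersurface S)
    (hV : HasPolynomialVolumeGrowth S) {g : Ambient n → ℝ} (hg : ContDiff ℝ ∞ g)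
    {K : Set (Ambient n)} (hK : IsCompact K) (hKS : K ⊆ S) (h0 : ∀ x ∈ S \ K, g x = 0) {ε : ℝ}
    (hε : ∀ x ∈ S, ‖fderiv ℝ g x‖ ≤ ε) :
    gaussianIntegral S (fun x => ‖tangentialGradient S g x‖ ^ 2
      - secondFundamentalFormNormSq S x * g x ^ 2 - 1 / 2 * g x ^ 2) ≤
        ε ^ 2 * (∫ x in S, Real.exp (-‖x‖ ^ 2 / 4) ∂μHE[n]) -
          1 / 2 * gaussianIntegral S (fun x => g x ^ 2) := by
  have hgd : Differentiable ℝ g := hg.differentiable (by simp)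
  have hw : Continuous fun x : Ambient n => Real.exp (-‖x‖ ^ 2 / 4) := by fun_prop
  have hSm := measurableSet_of_isSmoothHypersurface hS
  have hVint := integrableOn_gaussian hV
  have hDint : IntegrableOn (fun x => g x ^ 2 * Real.exp (-‖x‖ ^ 2 / 4)) S μHE[n] :=
    integrableOn_of_continuousOn hS hV ((hg.continuous.pow 2).mul hw).continuousOn hK hKS
      fun x hx => by simp [h0 x hx]
  have hAint : IntegrableOn (fun x => secondFundamentalFormNormSq S x * g x ^ 2 *
      Real.exp (-‖x‖ ^ 2 / 4)) S μHE[n] :=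
    integrableOn_of_continuousOn hS hV (((continuousOn_secondFundamentalFormNormSq hS).mul
      (hg.continuous.pow 2).continuousOn).mul hw.continuousOn) hK hKS
      fun x hx => by simp [h0 x hx]
  have hgrad : ∀ x ∈ S, ‖tangentialGradient S g x‖ ^ 2 ≤ ε ^ 2 := fun x hx =>
    pow_le_pow_left₀ (norm_nonneg _) ((norm_tangentialGradient_le (hgd x)).trans (hε x hx)) 2
  have hGint : IntegrableOn (fun x => ‖tangentialGradient S g x‖ ^ 2 *
      Real.exp (-‖x‖ ^ 2 / 4)) S μHE[n] := by
    refine Integrable.mono' (hVint.const_mul (ε ^ 2))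
      (((continuousOn_norm_tangentialGradient_sq hS hg).mul
        hw.continuousOn).aestronglyMeasurable hSm) ?_
    filter_upwards [ae_restrict_mem hSm] with x hx
    rw [Real.norm_of_nonneg (by positivity)]
    exact mul_le_mul_of_nonneg_right (hgrad x hx) (Real.exp_pos _).le
  unfold gaussianIntegral
  rw [← integral_const_mul, ← integral_const_mul,
    ← integral_sub (hVint.const_mul _) (hDint.const_mul _)]
  refine setIntegral_mono_on ?_ ((hVint.const_mul _).sub (hDint.const_mul _)) hSm fun x hx => ?_
  · refine ((hGint.sub hAint).sub (hDint.const_mul (1 / 2))).congr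
      (Eventually.of_forall fun x => ?_)
    simp only [Pi.sub_apply]
    ring
  · have h1 := mul_le_mul_of_nonneg_right (hgrad x hx) (Real.exp_pos (-‖x‖ ^ 2 / 4)).le
    have h2 : 0 ≤ secondFundamentalFormNormSq S x * g x ^ 2 * Real.exp (-‖x‖ ^ 2 / 4) :=
      mul_nonneg (mul_nonneg (secondFundamentalFormNormSq_nonneg S x) (sq_nonneg _))
        (Real.exp_pos _).le
    linarith

theorem setIntegral_gaussian_inter_ball_pos (hS : IsSmoothHypersurface S)
    (hV : HasPolynomialVolumeGrowth S) {p : Ambient n} (hp : p ∈ S) {r : ℝ} (hr : 0 < r) :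
    0 < ∫ x in S ∩ ball p r, Real.exp (-‖x‖ ^ 2 / 4) ∂μHE[n] := by
  rw [setIntegral_pos_iff_support_of_nonneg_ae (Eventually.of_forall fun x => (Real.exp_pos _).le)
    ((integrableOn_gaussian hV).mono_set inter_subset_left)]
  have : Function.support (fun x : Ambient n => Real.exp (-‖x‖ ^ 2 / 4)) = univ :=
    Function.support_eq_univ fun x => (Real.exp_pos _).ne'
  rw [this, univ_inter]
  exact hausdorffMeasure_inter_ball_pos hS hp hr

/-- The lower bound ignores the support and gradient of `g`, so it survives as the cut-offs spread
out. -/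
theorem gaussianIntegral_sq_ge (hS : IsSmoothHypersurface S)
    (hV : HasPolynomialVolumeGrowth S) {g : Ambient n → ℝ} (hg : Continuous g)
    {K : Set (Ambient n)} (hK : IsCompact K) (hKS : K ⊆ S) (h0 : ∀ x ∈ S \ K, g x = 0)
    {p : Ambient n} {r a : ℝ} (ha : 0 ≤ a) (hag : ∀ x ∈ S ∩ ball p r, a ≤ g x) :
    a ^ 2 * (∫ x in S ∩ ball p r, Real.exp (-‖x‖ ^ 2 / 4) ∂μHE[n]) ≤
      gaussianIntegral S (fun x => g x ^ 2) := by
  have hw : Continuous fun x : Ambient n => Real.exp (-‖x‖ ^ 2 / 4) := by fun_prop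
  have hDint : IntegrableOn (fun x => g x ^ 2 * Real.exp (-‖x‖ ^ 2 / 4)) S μHE[n] :=
    integrableOn_of_continuousOn hS hV ((hg.pow 2).mul hw).continuousOn hK hKS
      fun x hx => by simp [h0 x hx]
  have hm : MeasurableSet (S ∩ ball p r) :=
    (measurableSet_of_isSmoothHypersurface hS).inter measurableSet_ball
  rw [← integral_const_mul]
  refine le_trans (setIntegral_mono_on
    (((integrableOn_gaussian hV).mono_set inter_subset_left).const_mul _)
    (hDint.mono_set inter_subset_left) hm fun x hx => ?_)
    (setIntegral_mono_set hDint (Eventually.of_forall fun x => by positivity)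
      (LE.le.eventuallyLE inter_subset_left))
  exact mul_le_mul_of_nonneg_right (pow_le_pow_left₀ ha (hag x hx) 2) (Real.exp_pos _).le

end Volume

end SelfShrinker

/-! ### Conclusion with cut-offs of small gradient -/

theorem theoremt (n : ℕ) (S : Set (SelfShrinker.Ambient n)) (hne : S.Nonempty)
    (hsmooth : SelfShrinker.IsSmoothHypersurface S)
    (hcomplete : SelfShrinker.IsIntrinsicallyComplete S)
    (hshrinker : SelfShrinker.SatisfiesShrinkerEquation S)
    (hgrowth : SelfShrinker.HasPolynomialVolumeGrowth S) :
    SelfShrinker.bottomOfSpectrum S ≤ ((-(1 / 2) : ℝ) : EReal) := by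
  obtain ⟨p, hp⟩ := hne
  obtain ⟨r, hr, hcut⟩ := SelfShrinker.exists_cutoff hsmooth hcomplete hp
  by_contra hlt
  obtain ⟨c, hc1, hc2⟩ := EReal.lt_iff_exists_real_btwn.1 (not_le.1 hlt)
  have hc : 0 < c + 1 / 2 := by linarith [EReal.coe_lt_coe_iff.1 hc1]
  have hI := SelfShrinker.setIntegral_gaussian_inter_ball_pos hsmooth hgrowth hp hr
  set I := ∫ x in S ∩ Metric.ball p r, Real.exp (-‖x‖ ^ 2 / 4) ∂μHE[n]
  have hV : 0 ≤ ∫ x in S, Real.exp (-‖x‖ ^ 2 / 4) ∂μHE[n] :=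
    MeasureTheory.integral_nonneg fun x => (Real.exp_pos _).le
  set D₀ := (1 / 4 : ℝ) ^ 2 * I with hD₀
  have hD₀pos : 0 < D₀ := by positivity
  -- `δ` is the squared gradient bound. With `V` the Gaussian volume and `D ≥ D₀` the denominator, a
  -- quotient above `c` would give `(c + 1/2) D < δ V ≤ (c + 1/2) D₀`. The `+ 1` keeps the divisor
  -- positive.
  set δ := (c + 1 / 2) * D₀ / ((∫ x in S, Real.exp (-‖x‖ ^ 2 / 4) ∂μHE[n]) + 1) with hδ
  have hδpos : 0 < δ := by positivity
  obtain ⟨g, hg, ⟨K, hKS, hK, h0⟩, hgp, hgd⟩ := hcut (Real.sqrt δ) (Real.sqrt_pos.2 hδpos)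
  have hN := SelfShrinker.gaussianIntegral_rayleigh_le hsmooth hgrowth hg hK hKS h0 hgd
  have hD := SelfShrinker.gaussianIntegral_sq_ge hsmooth hgrowth hg.continuous hK hKS h0
    (by norm_num) hgp
  rw [Real.sq_sqrt hδpos.le] at hN
  rw [← hD₀] at hD
  have htest : SelfShrinker.IsTestFunction S g :=
    { smooth := fun q _ => ⟨Set.univ, isOpen_univ, Set.mem_univ q, g, hg.contDiffOn, fun _ _ => rfl⟩
      compact_support := ⟨K, hKS, hK, h0⟩
      ne_zero := ⟨p, hp, 
        (lt_of_lt_of_le (by norm_num) (hgp p ⟨hp, Metric.mem_ball_self hr⟩)).ne'⟩ }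
  have hR : c < SelfShrinker.rayleighQuotient S g :=
    EReal.coe_lt_coe_iff.1 (hc2.trans_le (iInf_le (fun f : {f // SelfShrinker.IsTestFunction S f} =>
      ((SelfShrinker.rayleighQuotient S f.1 : ℝ) : EReal)) ⟨g, htest⟩))
  rw [SelfShrinker.rayleighQuotient, lt_div_iff₀ (hD₀pos.trans_le hD)] at hR
  have h1 : δ * (∫ x in S, Real.exp (-‖x‖ ^ 2 / 4) ∂μHE[n]) ≤ (c + 1 / 2) * D₀ := by
    have h2 : δ * ((∫ x in S, Real.exp (-‖x‖ ^ 2 / 4) ∂μHE[n]) + 1) = (c + 1 / 2) * D₀ := by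
      rw [hδ]; field_simp
    linarith
  have h3 := mul_le_mul_of_nonneg_left hD hc.le
  linarith
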